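/- Let $\alpha>2$ and, for $\epsilon>0$ and $X\in\mathbb R^2$, let $g_\epsilon(X)=\frac{1}{\epsilon+|X|^{\alpha}}$ be the regularised path loss. Consider interferers in the plane located at the points of one of the following two cluster processes $\Phi$. (M) *Matérn cluster process* (MCP) with parameters $\lambda_{\mathsf M^o},c_{\mathsf M},R_{\mathsf M}>0$: the parents form a homogeneous Poisson point process of density $\lambda_{\mathsf M^o}$; independently for each parent, the cluster has a Poisson number (mean $c_{\mathsf M}$) of points, independent and uniformly distributed in the disk of radius $R_{\mathsf M}$ centered at the parent. $\Phi$ consists of all cluster points. (S) *Second-order cluster process* (SOCP) with parameters $\lambda_{\mathsf S^o},c_{\mathsf S'},R_{\mathsf S'},\sigma,c_{\mathsf S},R_{\mathsf S}>0$: the parents form a homogeneous Poisson point process of density $\lambda_{\mathsf S^o}$; each parent has, independently, a Poisson number (mean $c_{\mathsf S'}$) of first-order points, displaced from it by independent vectors whose density at $x\in\mathbb R^2$ is proportional to $1-e^{-|x|^2/(2\sigma^2)}$ on $|x|\le R_{\mathsf S'}$ and zero elsewhere; each first-order point has, independently, a Poisson number (mean $c_{\mathsf S}$) of daughter points, independent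 and uniformly distributed in the disk of radius $R_{\mathsf S}$ centered at it. $\Phi$ consists of all daughter points. Let the power gains $h_{X,U}(t)$ from interferer $X\in\Phi$ to location $U\in\mathbb R^2$ in time slot $t$ be those of Rayleigh fading with unit mean, i.e. exponentially distributed with mean $1$, independent over all $(X,U,t)$ and independent of $\Phi$; let $h$ denote a variable with this law. Let $I_\epsilon(U,t)=\sum_{X\in\Phi}h_{X,U}(t)\,g_\epsilon(X-U)$. For $(U_1,t_1)\ne(U_2,t_2)$ the interference correlation coefficient is $$\zeta(U_1,U_2,t_1,t_2)=\lim_{\epsilon\to0^+}\frac{\mathbb E[I_\epsilon(U_1,t_1)I_\epsilon(U_2,t_2)]-\mathbb E[I_\epsilon(U_1,t_1)]\,\mathbb E[I_\epsilon(U_2,t_2)]}{\sqrt{\mathrm{var}(I_\epsilon(U_1,t_1))}\sqrt{\mathrm{var}(I_\epsilon(U_2,t_2))}}.$$ For $c,R>0$ set $$F_\epsilon(c,R)=\frac{c}{\pi^2R^4}\int_{\mathbb R^2}\int_{\mathbb R^2}g_\epsilon(X)g_\epsilon(Y)A_R(|X-Y|)\,dX\,dY,$$ $$A_R(r)=2R^2\arccos\Big(\frac{r}{2R}\Big)-r\sqrt{R^2-\frac{r^2}{4}}\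 \ (0\le r\le 2R),\qquad A_R(r)=0\ \text{ otherwise.}$$ **Theorem.** For every $\epsilon>0$ the interference $I_\epsilon(U,t)$ is almost surely a convergent sum with finite second moment and positive variance, and all the integrals below converge. The limit defining $\zeta(U_1,U_2,t_1,t_2)$ exists, both for the MCP and for the SOCP, and in both cases $$\zeta(U_1,U_2,t_1,t_2)=\lim_{\epsilon\to0^+}\frac{\int_{\mathbb R^2}g_\epsilon(X)\,g_\epsilon(X-U_1+U_2)\,dX+F_\epsilon(c,R)}{\frac{\mathbb E[h^2]}{\mathbb E[h]^2}\int_{\mathbb R^2}g_\epsilon(X)^2\,dX+F_\epsilon(c,R)},$$ where $(c,R)=(c_{\mathsf M},R_{\mathsf M})$ for the MCP and $(c,R)=(c_{\mathsf S},R_{\mathsf S})$ for the SOCP. -/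

import Mathlib

open MeasureTheory ProbabilityTheory Filter Topology
open scoped ENNReal NNReal

noncomputable section

/-- The Euclidean plane, with its Lebesgue measure `volume` and norm `|X|`. -/
abbrev Plane : Type := EuclideanSpace ℝ (Fin 2)

/-! ### Point processes -/

/-- The counting measure `∑ i, δ_{Z i ω}` of an enumerated random family of points. -/
def countingMeasure {Ω E : Type*} [MeasurableSpace E] (Z : ℕ → Ω → E) (ω : Ω) : Measure E :=
  Measure.sum fun i => Measure.dirac (Z i ω)

/-- The points `Z 0, Z 1, …` enumerate a Poisson point process with intensity measure `μ`:
the number of points in a measurable set `B` with `μ B < ∞` is Poisson distributed with mean `μ B`,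
and the numbers of points in disjoint measurable sets are independent. -/
structure IsPoissonProcess {Ω E : Type*} [MeasurableSpace Ω] [MeasurableSpace E]
    (Z : ℕ → Ω → E) (μ : Measure E) (P : Measure Ω) : Prop where
  measurable : ∀ i, Measurable (Z i)
  law_count : ∀ B : Set E, MeasurableSet B → μ B ≠ ∞ →
    HasLaw (fun ω => countingMeasure Z ω B)
      ((poissonMeasure (μ B).toNNReal).map fun n : ℕ => (n : ℝ≥0∞)) P
  indep_count : ∀ (n : ℕ) (B : Fin n → Set E), (∀ j, MeasurableSet (B j)) →
    Pairwise (fun j k => Disjoint (B j) (B k)) →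
    iIndepFun (fun j ω => countingMeasure Z ω (B j)) P

/-- The law on the plane with rotation invariant density `x ↦ f |x|`. -/
def isotropicLaw (f : ℝ → ℝ) : Measure Plane :=
  volume.withDensity fun x => ENNReal.ofReal (f ‖x‖)

/-- The uniform density on the disk of radius `R`. -/
def uniformDensity (R r : ℝ) : ℝ :=
  if r ≤ R then 1 / (Real.pi * R ^ 2) else 0

/-- The reverse Gaussian density with parameter `σ` on the disk of radius `R`. -/
def reverseGaussianDensity (R σ r : ℝ) : ℝ :=
  if r ≤ R then
    (1 - Real.exp (-r ^ 2 / (2 * σ ^ 2))) /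
      (Real.pi * R ^ 2 + 2 * Real.pi * σ ^ 2 * (Real.exp (-R ^ 2 / (2 * σ ^ 2)) - 1))
  else 0

/-- A Matérn cluster process: Poisson parents of density `lam`; the cluster of the `i`-th parent
has a Poisson number (mean `c`) of daughter points, uniformly distributed in the disk of radius `R`
around the parent; parents, cluster sizes and displacements are independent. Only the first
`number i` of the displacements `offset i 0, offset i 1, …` are used. -/
structure MaternClusterProcess {Ω : Type*} [MeasurableSpace Ω] (P : Measure Ω)
    (lam c R : ℝ) where
  parent : ℕ → Ω → Plane
  number : ℕ → Ω → ℕ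
  offset : ℕ → ℕ → Ω → Plane
  poisson_parent : IsPoissonProcess parent (ENNReal.ofReal lam • (volume : Measure Plane)) P
  measurable_number : ∀ i, Measurable (number i)
  measurable_offset : ∀ i k, Measurable (offset i k)
  law_number : ∀ i, HasLaw (number i) (poissonMeasure c.toNNReal) P
  law_offset : ∀ i k, HasLaw (offset i k) (isotropicLaw (uniformDensity R)) P
  iIndep_number : iIndepFun number P
  iIndep_offset : iIndepFun (fun p : ℕ × ℕ => offset p.1 p.2) P
  indep_parent : IndepFun (fun ω i => parent i ω)
    (fun ω => ((fun i => number i ω), (fun i k => offset i k ω))) P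
  indep_number_offset : IndepFun (fun ω i => number i ω) (fun ω i k => offset i k ω) P

namespace MaternClusterProcess

variable {Ω : Type*} [MeasurableSpace Ω] {P : Measure Ω} {lam c R : ℝ}

/-- The position of the `k`-th daughter of the `i`-th parent, if there is such a daughter. -/
def position (Φ : MaternClusterProcess P lam c R) (p : ℕ × ℕ) (ω : Ω) : Option Plane :=
  if p.2 < Φ.number p.1 ω then some (Φ.parent p.1 ω + Φ.offset p.1 p.2 ω) else none

/-- All the random variables from which the process is built. -/
def data (Φ : MaternClusterProcess P lam c R) (ω : Ω) :
    (ℕ → Plane) × (ℕ → ℕ) × (ℕ → ℕ → Plane) :=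
  (fun i => Φ.parent i ω, fun i => Φ.number i ω, fun i k => Φ.offset i k ω)

end MaternClusterProcess

/-- A second-order cluster process: Poisson parents of density `lam`; the first-order cluster of
the `i`-th parent has a Poisson number (mean `c'`) of points, displaced from the parent with the
reverse Gaussian density (parameters `R'`, `σ`); the second-order cluster of the `j`-th of these
has a Poisson number (mean `c`) of daughter points, uniformly distributed in the disk of radius `R`
around it; all these random choices are independent. -/
structure SecondOrderClusterProcess {Ω : Type*} [MeasurableSpace Ω] (P : Measure Ω)
    (lam c' R' σ c R : ℝ) where
  parent : ℕ → Ω → Plane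
  number₁ : ℕ → Ω → ℕ
  offset₁ : ℕ → ℕ → Ω → Plane
  number₂ : ℕ → ℕ → Ω → ℕ
  offset₂ : ℕ → ℕ → ℕ → Ω → Plane
  poisson_parent : IsPoissonProcess parent (ENNReal.ofReal lam • (volume : Measure Plane)) P
  measurable_number₁ : ∀ i, Measurable (number₁ i)
  measurable_offset₁ : ∀ i j, Measurable (offset₁ i j)
  measurable_number₂ : ∀ i j, Measurable (number₂ i j)
  measurable_offset₂ : ∀ i j k, Measurable (offset₂ i j k)
  law_number₁ : ∀ i, HasLaw (number₁ i) (poissonMeasure c'.toNNReal) P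
  law_offset₁ : ∀ i j, HasLaw (offset₁ i j) (isotropicLaw (reverseGaussianDensity R' σ)) P
  law_number₂ : ∀ i j, HasLaw (number₂ i j) (poissonMeasure c.toNNReal) P
  law_offset₂ : ∀ i j k, HasLaw (offset₂ i j k) (isotropicLaw (uniformDensity R)) P
  iIndep_number₁ : iIndepFun number₁ P
  iIndep_offset₁ : iIndepFun (fun p : ℕ × ℕ => offset₁ p.1 p.2) P
  iIndep_number₂ : iIndepFun (fun p : ℕ × ℕ => number₂ p.1 p.2) P
  iIndep_offset₂ : iIndepFun (fun p : ℕ × ℕ × ℕ => offset₂ p.1 p.2.1 p.2.2) P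
  indep_parent : IndepFun (fun ω i => parent i ω)
    (fun ω => ((fun i => number₁ i ω), (fun i j => offset₁ i j ω),
      (fun i j => number₂ i j ω), (fun i j k => offset₂ i j k ω))) P
  indep_number₁ : IndepFun (fun ω i => number₁ i ω)
    (fun ω => ((fun i j => offset₁ i j ω),
      (fun i j => number₂ i j ω), (fun i j k => offset₂ i j k ω))) P
  indep_offset₁ : IndepFun (fun ω i j => offset₁ i j ω)
    (fun ω => ((fun i j => number₂ i j ω), (fun i j k => offset₂ i j k ω))) P
  indep_number₂ : IndepFun (fun ω i j => number₂ i j ω) (fun ω i j k => offset₂ i j k ω) P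

namespace SecondOrderClusterProcess

variable {Ω : Type*} [MeasurableSpace Ω] {P : Measure Ω} {lam c' R' σ c R : ℝ}

/-- The position of the `k`-th daughter of the `j`-th first-order point of the `i`-th parent,
if there is such a daughter. -/
def position (Φ : SecondOrderClusterProcess P lam c' R' σ c R) (p : ℕ × ℕ × ℕ) (ω : Ω) :
    Option Plane :=
  if p.2.1 < Φ.number₁ p.1 ω ∧ p.2.2 < Φ.number₂ p.1 p.2.1 ω then
    some (Φ.parent p.1 ω + Φ.offset₁ p.1 p.2.1 ω + Φ.offset₂ p.1 p.2.1 p.2.2 ω)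
  else none

/-- All the random variables from which the process is built. -/
def data (Φ : SecondOrderClusterProcess P lam c' R' σ c R) (ω : Ω) :
    (ℕ → Plane) × (ℕ → ℕ) × (ℕ → ℕ → Plane) × (ℕ → ℕ → ℕ) × (ℕ → ℕ → ℕ → Plane) :=
  (fun i => Φ.parent i ω, fun i => Φ.number₁ i ω, fun i j => Φ.offset₁ i j ω,
    fun i j => Φ.number₂ i j ω, fun i j k => Φ.offset₂ i j k ω)

end SecondOrderClusterProcess

/-! ### Interference -/

/-- Rayleigh fading with unit mean power gain: the gains `h p U t` from the interferer with label
`p` to the location `U` in slot `t` are exponentially distributed with mean one, independent for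
different `(p, U, t)`, and jointly independent of the interferer process (given by `data`). -/
structure IsRayleighFading {Ω ι β : Type*} [MeasurableSpace Ω] [MeasurableSpace β]
    (h : ι → Plane → ℕ → Ω → ℝ) (data : Ω → β) (P : Measure Ω) : Prop where
  measurable : ∀ p U t, Measurable (h p U t)
  law : ∀ p U t, HasLaw (h p U t) (expMeasure 1) P
  iIndep : iIndepFun (fun q : ι × Plane × ℕ => h q.1 q.2.1 q.2.2) P
  indep_data : IndepFun (fun ω (q : ι × Plane × ℕ) => h q.1 q.2.1 q.2.2 ω) data P

/-- The regularised path loss `g_ε(x) = 1 / (ε + |x|^α)`. -/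
def pathLoss (α ε : ℝ) (x : Plane) : ℝ := 1 / (ε + ‖x‖ ^ α)

/-- The contribution of the interferer with label `p` to the interference at `U` in slot `t`. -/
def interferenceTerm {Ω ι : Type*} (α ε : ℝ) (position : ι → Ω → Option Plane)
    (h : ι → Plane → ℕ → Ω → ℝ) (U : Plane) (t : ℕ) (ω : Ω) (p : ι) : ℝ :=
  (position p ω).elim 0 fun x => h p U t ω * pathLoss α ε (x - U)

/-- The interference power `I_ε(U, t)`. -/
def interference {Ω ι : Type*} (α ε : ℝ) (position : ι → Ω → Option Plane)
    (h : ι → Plane → ℕ → Ω → ℝ) (U : Plane) (t : ℕ) (ω : Ω) : ℝ :=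
  ∑' p, interferenceTerm α ε position h U t ω p

/-- The interference power `I_ε(U, t)` is an almost surely convergent sum, has a finite second
moment, and is not almost surely constant. -/
def InterferenceRegular {Ω ι : Type*} [MeasurableSpace Ω] (P : Measure Ω) (α ε : ℝ)
    (position : ι → Ω → Option Plane) (h : ι → Plane → ℕ → Ω → ℝ) (U : Plane) (t : ℕ) : Prop :=
  (∀ᵐ ω ∂P, Summable (interferenceTerm α ε position h U t ω)) ∧
    MemLp (interference α ε position h U t) 2 P ∧
    0 < variance (interference α ε position h U t) P

/-- The normalised covariance of two random variables. -/
def correlation {Ω : Type*} [MeasurableSpace Ω] (P : Measure Ω) (I J : Ω → ℝ) : ℝ :=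
  ((∫ ω, I ω * J ω ∂P) - (∫ ω, I ω ∂P) * ∫ ω, J ω ∂P) / (√(variance I P) * √(variance J P))

/-- `ζ` is the interference correlation coefficient `ζ(U₁, U₂, t₁, t₂)`: for every `ε > 0` the
normalised covariance of `I_ε(U₁, t₁)` and `I_ε(U₂, t₂)` is meaningful, and it tends to `ζ`
as `ε → 0`. -/
def IsInterferenceCorrelation {Ω ι : Type*} [MeasurableSpace Ω] (P : Measure Ω) (α : ℝ)
    (position : ι → Ω → Option Plane) (h : ι → Plane → ℕ → Ω → ℝ)
    (U₁ U₂ : Plane) (t₁ t₂ : ℕ) (ζ : ℝ) : Prop :=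
  (∀ ε : ℝ, 0 < ε → InterferenceRegular P α ε position h U₁ t₁ ∧
    InterferenceRegular P α ε position h U₂ t₂) ∧
  Tendsto (fun ε : ℝ => correlation P (interference α ε position h U₁ t₁)
    (interference α ε position h U₂ t₂)) (𝓝[>] 0) (𝓝 ζ)

/-! ### The closed form -/

/-- The area `A_R(r)` of the intersection of two disks of radius `R` with centers at
distance `r`. -/
def diskOverlap (R r : ℝ) : ℝ :=
  if 0 ≤ r ∧ r ≤ 2 * R then
    2 * R ^ 2 * Real.arccos (r / (2 * R)) - r * √(R ^ 2 - r ^ 2 / 4)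
  else 0

/-- `F_ε(c, R)`, the clustering term. -/
def clusterTerm (α ε c R : ℝ) : ℝ :=
  c / (Real.pi ^ 2 * R ^ 4) *
    ∫ x : Plane, ∫ y : Plane, pathLoss α ε x * pathLoss α ε y * diskOverlap R ‖x - y‖

/-- The ratio whose limit as `ε → 0` is the interference correlation coefficient. -/
def correlationRatio (α ε c R : ℝ) (U₁ U₂ : Plane) : ℝ :=
  ((∫ x : Plane, pathLoss α ε x * pathLoss α ε (x - U₁ + U₂)) + clusterTerm α ε c R) /
    ((∫ s : ℝ, s ^ 2 ∂(expMeasure 1)) / (∫ s : ℝ, s ∂(expMeasure 1)) ^ 2 *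
      (∫ x : Plane, pathLoss α ε x ^ 2) + clusterTerm α ε c R)

end

/-! ### Moments of Poisson variables and Poisson processes -/

/-! Both limits can be computed, and they agree: each is 1/2 if `U₁ = U₂` and 0 otherwise. Write
G(ε) and S(ε) for the integrals of g_ε and g_ε². For either process, with λ the density of Φ,
Campbell's formulas give the covariance λ ∫ g_ε(x) g_ε(x + U₂ - U₁) dx + Q and the variance 2λ S(ε)
+ Q'. The factor 2 is E[h²], and the excesses Q, Q' come from pairs of distinct points with a common
ancestor. Since the displacement densities are bounded, the excesses are at most B G(ε)² with B
independent of ε. Since A_R is bounded, F_ε is also O(G(ε)²).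

The substitution x ↦ ε^(1/α) x shows that G(ε) is a constant times ε^(2/α - 1) and S(ε) a constant
times ε^(2/α - 2). Hence G²/S and G/S tend to 0. After division by S every clustering term vanishes
in the limit, while the shifted product integral equals S for shift zero and is O(G) for any other
shift. So the excess never has to be identified with F_ε; only its order of magnitude matters.

The probabilistic half rests on `IsPoissonProcess.tsum_tsum_lintegral` and on
`HasPairMoments.cluster`, used once for the MCP and twice for the SOCP; these feed
`HasPairMoments.integral_interference_mul` and `HasPairMoments.memLp_interference_and_variance`. The
analytic half is `tendsto_covariance_div_sqrt_variance` and `tendsto_covariance_div_variance`. -/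

/-- The terms with n < k vanish. After the shift n ↦ n + k the falling factorial cancels against (n
+ k)!, which leaves r^k times the total mass 1. -/
theorem lintegral_descFactorial_poissonMeasure (r : ℝ≥0) (k : ℕ) :
    ∫⁻ n : ℕ, (n.descFactorial k : ℝ≥0∞) ∂(poissonMeasure r) = (r : ℝ≥0∞) ^ k := by
  have h1 : ∫⁻ _ : ℕ, (1 : ℝ≥0∞) ∂(poissonMeasure r) = 1 := by
    rw [lintegral_const, measure_univ, mul_one]
  have h0 (f : ℕ → ℝ≥0∞) : ∫⁻ n, f n ∂(poissonMeasure r) =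
      ∑' n : ℕ, ENNReal.ofReal (Real.exp (-r) * r ^ n / n.factorial) * f n := by
    rw [poissonMeasure, lintegral_sum_measure]
    refine tsum_congr fun n => ?_
    rw [lintegral_smul_measure, lintegral_dirac, smul_eq_mul]
  simp_rw [h0, mul_one] at h1
  rw [h0]
  rw [← Summable.sum_add_tsum_nat_add' (k := k) ENNReal.summable, Finset.sum_eq_zero, zero_add]
  · rw [← mul_one ((r : ℝ≥0∞) ^ k), ← h1, ← ENNReal.tsum_mul_left]
    refine tsum_congr fun n => ?_
    have h2 : ((n + k).descFactorial k : ℝ≥0∞) = ENNReal.ofReal ((n + k).descFactorial k : ℝ) := by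
      simp
    have h3 : (r : ℝ≥0∞) ^ k = ENNReal.ofReal ((r : ℝ) ^ k) := by
      rw [ENNReal.ofReal_pow (NNReal.coe_nonneg r), ENNReal.ofReal_coe_nnreal]
    rw [h2, h3, ← ENNReal.ofReal_mul (by positivity), ← ENNReal.ofReal_mul (by positivity)]
    congr 1
    have h4 := Nat.factorial_mul_descFactorial (Nat.le_add_left k n)
    rw [Nat.add_sub_cancel] at h4
    have h5 : ((n + k).factorial : ℝ) = n.factorial * (n + k).descFactorial k := by
      exact_mod_cast h4.symm
    have h6 : ((n + k).descFactorial k : ℝ) ≠ 0 := by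
      rw [Nat.cast_ne_zero, Ne, Nat.descFactorial_eq_zero_iff_lt]
      omega
    have h7 : (n.factorial : ℝ) ≠ 0 := by positivity
    rw [h5, pow_add]
    field_simp
  · intro i hi
    rw [Nat.descFactorial_of_lt (Finset.mem_range.1 hi)]
    simp

theorem lintegral_natCast_poissonMeasure (r : ℝ≥0) :
    ∫⁻ n : ℕ, (n : ℝ≥0∞) ∂(poissonMeasure r) = r := by
  simpa using lintegral_descFactorial_poissonMeasure r 1

theorem lintegral_natCast_sq_poissonMeasure (r : ℝ≥0) :
    ∫⁻ n : ℕ, (n : ℝ≥0∞) * n ∂(poissonMeasure r) = (r : ℝ≥0∞) * r + r := by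
  have h (n : ℕ) : (n : ℝ≥0∞) * n = (n.descFactorial 2 : ℝ≥0∞) + n := by
    rcases n with _ | n
    · simp
    · simp only [Nat.descFactorial_succ, Nat.descFactorial_zero]
      norm_cast
      simp
      ring
  simp_rw [h]
  rw [lintegral_add_right _ (by fun_prop), lintegral_descFactorial_poissonMeasure,
    lintegral_natCast_poissonMeasure, sq]

section PoissonProcess

variable {Ω E : Type*} [MeasurableSpace Ω] [MeasurableSpace E] {Z : ℕ → Ω → E} {μ : Measure E}
  {P : Measure Ω}

omit [MeasurableSpace Ω] in
theorem countingMeasure_apply (Z : ℕ → Ω → E) (ω : Ω) {B : Set E} (hB : MeasurableSet B) :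
    countingMeasure Z ω B = ∑' i, B.indicator 1 (Z i ω) := by
  simp [countingMeasure, Measure.sum_apply _ hB, Measure.dirac_apply' _ hB]

/-- The counts are controlled only on sets of finite intensity. By σ-finiteness these still
generate, so measures can be compared on them. -/
theorem generateFrom_measurableSet_ne_top (μ : Measure E) [SigmaFinite μ] :
    MeasurableSpace.generateFrom {s : Set E | MeasurableSet s ∧ μ s ≠ ∞} = ‹MeasurableSpace E› := by
  refine le_antisymm (MeasurableSpace.generateFrom_le fun s hs => hs.1) fun s hs => ?_
  rw [← Set.inter_univ s, ← iUnion_spanningSets μ, Set.inter_iUnion]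
  refine MeasurableSet.iUnion fun n => MeasurableSpace.measurableSet_generateFrom
    ⟨hs.inter (measurableSet_spanningSets μ n), ne_top_of_le_ne_top
      (measure_spanningSets_lt_top μ n).ne (measure_mono Set.inter_subset_right)⟩

theorem isPiSystem_measurableSet_ne_top (μ : Measure E) :
    IsPiSystem {s : Set E | MeasurableSet s ∧ μ s ≠ ∞} := fun _ hs _ ht _ =>
  ⟨hs.1.inter ht.1, ne_top_of_le_ne_top hs.2 (measure_mono Set.inter_subset_left)⟩

namespace IsPoissonProcess

theorem measurable_count (hZ : IsPoissonProcess Z μ P) {B : Set E} (hB : MeasurableSet B) :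
    Measurable fun ω => countingMeasure Z ω B := by
  simp_rw [countingMeasure_apply Z _ hB]
  exact Measurable.tsum fun i => (measurable_one.indicator hB).comp (hZ.measurable i)

theorem lintegral_count (hZ : IsPoissonProcess Z μ P) {B : Set E} (hB : MeasurableSet B)
    (hμ : μ B ≠ ∞) : ∫⁻ ω, countingMeasure Z ω B ∂P = μ B := by
  have := (hZ.law_count B hB hμ).lintegral_comp (f := fun x => x) (by fun_prop)
  rw [this, lintegral_map (by fun_prop) .of_discrete, lintegral_natCast_poissonMeasure,
    ENNReal.coe_toNNReal hμ]

theorem lintegral_count_sq (hZ : IsPoissonProcess Z μ P) {B : Set E} (hB : MeasurableSet B)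
    (hμ : μ B ≠ ∞) :
    ∫⁻ ω, countingMeasure Z ω B * countingMeasure Z ω B ∂P = μ B * μ B + μ B := by
  have := (hZ.law_count B hB hμ).lintegral_comp (f := fun x => x * x) (by fun_prop)
  rw [this, lintegral_map (by fun_prop) .of_discrete, lintegral_natCast_sq_poissonMeasure,
    ENNReal.coe_toNNReal hμ]

theorem lintegral_count_mul_of_disjoint (hZ : IsPoissonProcess Z μ P) {A B : Set E}
    (hA : MeasurableSet A) (hB : MeasurableSet B) (hAB : Disjoint A B) (hμA : μ A ≠ ∞)
    (hμB : μ B ≠ ∞) :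
    ∫⁻ ω, countingMeasure Z ω A * countingMeasure Z ω B ∂P = μ A * μ B := by
  have h := hZ.indep_count 2 ![A, B] (Fin.forall_fin_two.2 ⟨hA, hB⟩) (by
    simp [Pairwise, Fin.forall_fin_two, hAB, hAB.symm])
  have h' := h.indepFun (show (0 : Fin 2) ≠ 1 by simp)
  simp only [Matrix.cons_val_zero, Matrix.cons_val_one] at h'
  rw [← hZ.lintegral_count hA hμA, ← hZ.lintegral_count hB hμB]
  exact lintegral_mul_eq_lintegral_mul_lintegral_of_indepFun (hZ.measurable_count hA)
    (hZ.measurable_count hB) h'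

/-- Both sets are split along A ∩ B. Counts of disjoint pieces are independent, so only the square
of the count of A ∩ B contributes beyond the product of means, namely a Poisson variance. -/
theorem lintegral_count_mul (hZ : IsPoissonProcess Z μ P) {A B : Set E}
    (hA : MeasurableSet A) (hB : MeasurableSet B) (hμA : μ A ≠ ∞) (hμB : μ B ≠ ∞) :
    ∫⁻ ω, countingMeasure Z ω A * countingMeasure Z ω B ∂P = μ A * μ B + μ (A ∩ B) := by
  have hC := hA.inter hB
  have hμC : μ (A ∩ B) ≠ ∞ := ne_top_of_le_ne_top hμA (measure_mono Set.inter_subset_left)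
  have hA' := hA.diff hB
  have hμA' : μ (A \ B) ≠ ∞ := ne_top_of_le_ne_top hμA (measure_mono Set.sdiff_subset)
  have hB' := hB.diff hA
  have hμB' : μ (B \ A) ≠ ∞ := ne_top_of_le_ne_top hμB (measure_mono Set.sdiff_subset)
  have e (ν : Measure E) : ν A = ν (A ∩ B) + ν (A \ B) := (measure_inter_add_sdiff A hB).symm
  have e' (ν : Measure E) : ν B = ν (A ∩ B) + ν (B \ A) := by
    rw [Set.inter_comm]; exact (measure_inter_add_sdiff B hA).symm
  have m {S : Set E} (hS : MeasurableSet S) := hZ.measurable_count hS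
  have key (ω : Ω) : countingMeasure Z ω A * countingMeasure Z ω B =
      countingMeasure Z ω (A ∩ B) * countingMeasure Z ω (A ∩ B) +
      (countingMeasure Z ω (A ∩ B) * countingMeasure Z ω (B \ A) +
      (countingMeasure Z ω (A \ B) * countingMeasure Z ω (A ∩ B) +
      countingMeasure Z ω (A \ B) * countingMeasure Z ω (B \ A))) := by
    rw [e (countingMeasure Z ω), e' (countingMeasure Z ω)]
    ring
  simp_rw [key]
  have mC := m hC
  have mA := m hA'
  have mB := m hB'
  rw [lintegral_add_left (by fun_prop), lintegral_add_left (by fun_prop),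
    lintegral_add_left (by fun_prop), hZ.lintegral_count_sq hC hμC,
    hZ.lintegral_count_mul_of_disjoint hC hB' (by
      rw [Set.disjoint_left]; rintro x ⟨h1, h2⟩ ⟨h3, h4⟩; exact h4 h1) hμC hμB',
    hZ.lintegral_count_mul_of_disjoint hA' hC (by
      rw [Set.disjoint_left]; rintro x ⟨h1, h2⟩ ⟨h3, h4⟩; exact h2 h4) hμA' hμC,
    hZ.lintegral_count_mul_of_disjoint hA' hB' (by
      rw [Set.disjoint_left]; rintro x ⟨h1, h2⟩ ⟨h3, h4⟩; exact h2 h3) hμA' hμB',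
    e μ, e' μ]
  ring

/-- Campbell's formula for a Poisson process. -/
theorem tsum_lintegral (hZ : IsPoissonProcess Z μ P) [SigmaFinite μ] {f : E → ℝ≥0∞}
    (hf : Measurable f) : ∑' i, ∫⁻ ω, f (Z i ω) ∂P = ∫⁻ x, f x ∂μ := by
  -- The formula says that the intensity is the sum of the laws of the points. It suffices to test
  -- this on the π-system of sets of finite intensity.
  have : μ = Measure.sum fun i => P.map (Z i) := by
    refine Measure.ext_of_generateFrom_of_iUnion _ (spanningSets μ)
      (generateFrom_measurableSet_ne_top μ).symm (isPiSystem_measurableSet_ne_top μ)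
      (iUnion_spanningSets μ)
      (fun i => ⟨measurableSet_spanningSets μ i, (measure_spanningSets_lt_top μ i).ne⟩)
      (fun i => (measure_spanningSets_lt_top μ i).ne) fun s hs => ?_
    rw [← hZ.lintegral_count hs.1 hs.2, Measure.sum_apply _ hs.1]
    simp_rw [countingMeasure_apply Z _ hs.1]
    have ms (i) : Measurable fun ω => s.indicator (1 : E → ℝ≥0∞) (Z i ω) :=
      (measurable_one.indicator hs.1).comp (hZ.measurable i)
    rw [lintegral_tsum fun i => (ms i).aemeasurable]
    refine tsum_congr fun i => ?_
    rw [← lintegral_map (f := s.indicator 1) (measurable_one.indicator hs.1) (hZ.measurable i),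
      lintegral_indicator_one hs.1]
  rw [this, lintegral_sum_measure]
  exact tsum_congr fun i => (lintegral_map hf (hZ.measurable i)).symm

/-- The second-order Campbell formula for a Poisson process, sums over all pairs of points. -/
theorem tsum_tsum_lintegral (hZ : IsPoissonProcess Z μ P) [SigmaFinite μ] {F : E × E → ℝ≥0∞}
    (hF : Measurable F) : ∑' i, ∑' j, ∫⁻ ω, F (Z i ω, Z j ω) ∂P =
      ∫⁻ x, ∫⁻ y, F (x, y) ∂μ ∂μ + ∫⁻ x, F (x, x) ∂μ := by
  have hd : Measurable fun x : E => (x, x) := by fun_prop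
  have hZZ (i j) : Measurable fun ω => (Z i ω, Z j ω) :=
    (hZ.measurable i).prodMk (hZ.measurable j)
  let C := {s : Set E | MeasurableSet s ∧ μ s ≠ ∞}
  have hS (n : ℕ) : spanningSets μ n ∈ C :=
    ⟨measurableSet_spanningSets μ n, (measure_spanningSets_lt_top μ n).ne⟩
  have hspan : IsCountablySpanning C := ⟨spanningSets μ, hS, iUnion_spanningSets μ⟩
  have rect (ν : Measure E) [SigmaFinite ν] {s t : Set E} (hs : MeasurableSet s)
      (ht : MeasurableSet t) : (ν.prod ν + ν.map fun x => (x, x)) (s ×ˢ t) =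
        ν s * ν t + ν (s ∩ t) := by
    rw [Measure.add_apply, Measure.prod_prod, Measure.map_apply (by fun_prop) (hs.prod ht)]
    congr
  -- The same argument for pairs, tested on rectangles with sides of finite intensity; the image of
  -- μ on the diagonal accounts for a point paired with itself.
  have : μ.prod μ + μ.map (fun x => (x, x)) =
      Measure.sum fun p : ℕ × ℕ => P.map fun ω => (Z p.1 ω, Z p.2 ω) := by
    refine Measure.ext_of_generateFrom_of_iUnion (Set.image2 (· ×ˢ ·) C C)
      (fun n => spanningSets μ n ×ˢ spanningSets μ n)
      (generateFrom_eq_prod (generateFrom_measurableSet_ne_top μ)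
        (generateFrom_measurableSet_ne_top μ) hspan hspan).symm
      ((isPiSystem_measurableSet_ne_top μ).prod (isPiSystem_measurableSet_ne_top μ)) ?_
      (fun n => ⟨_, hS n, _, hS n, rfl⟩) (fun n => ?_) ?_
    · rw [Set.iUnion_prod_of_monotone (monotone_spanningSets μ) (monotone_spanningSets μ),
        iUnion_spanningSets, Set.univ_prod_univ]
    · rw [rect μ (hS n).1 (hS n).1, Set.inter_self]
      finiteness [(hS n).2]
    · rintro _ ⟨s, hs, t, ht, rfl⟩
      rw [rect μ hs.1 ht.1, ← hZ.lintegral_count_mul hs.1 ht.1 hs.2 ht.2,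
        Measure.sum_apply _ (hs.1.prod ht.1), ENNReal.tsum_prod']
      have ms (i) : Measurable fun ω => s.indicator (1 : E → ℝ≥0∞) (Z i ω) :=
        (measurable_one.indicator hs.1).comp (hZ.measurable i)
      have mt (i) : Measurable fun ω => t.indicator (1 : E → ℝ≥0∞) (Z i ω) :=
        (measurable_one.indicator ht.1).comp (hZ.measurable i)
      simp_rw [countingMeasure_apply Z _ hs.1, countingMeasure_apply Z _ ht.1,
        ← ENNReal.tsum_mul_right, ← ENNReal.tsum_mul_left]
      have mst (i j) : Measurable fun ω => s.indicator (1 : E → ℝ≥0∞) (Z i ω) *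
          t.indicator (1 : E → ℝ≥0∞) (Z j ω) := (ms i).mul (mt j)
      rw [lintegral_tsum fun i => (Measurable.tsum fun j => mst i j).aemeasurable]
      refine tsum_congr fun i => ?_
      rw [lintegral_tsum fun j => (mst i j).aemeasurable]
      refine tsum_congr fun j => ?_
      rw [← lintegral_indicator_one (hs.1.prod ht.1),
        lintegral_map (measurable_one.indicator (hs.1.prod ht.1)) (hZZ i j)]
      refine lintegral_congr fun ω => ?_
      by_cases h1 : Z i ω ∈ s <;> by_cases h2 : Z j ω ∈ t <;> simp [Set.indicator, h1, h2]
  have key := congrArg (fun m => ∫⁻ z, F z ∂m) this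
  simp only [lintegral_add_measure, lintegral_sum_measure] at key
  rw [lintegral_prod _ hF.aemeasurable, lintegral_map hF hd, ENNReal.tsum_prod'] at key
  rw [key]
  exact tsum_congr fun i => tsum_congr fun j => (lintegral_map hF (hZZ i j)).symm

end IsPoissonProcess

end PoissonProcess

/-! ### Pair moments of thinned families of points, and their stability under clustering -/

section Independence

variable {Ω α β γ : Type*} [MeasurableSpace Ω] [MeasurableSpace α] [MeasurableSpace β]
  [MeasurableSpace γ] {P : Measure Ω} [IsProbabilityMeasure P]

/-- The joint law of the triple is the product of the three marginals, and this product may be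
bracketed either way. -/
theorem IndepFun.prodMk_left {A : Ω → α} {N : Ω → β} {O : Ω → γ} (hA : Measurable A)
    (hN : Measurable N) (hO : Measurable O) (h1 : IndepFun A (fun ω => (N ω, O ω)) P)
    (h2 : IndepFun N O P) : IndepFun (fun ω => (A ω, N ω)) O P := by
  have hAN : IndepFun A N P := h1.comp measurable_id measurable_fst
  rw [indepFun_iff_map_prod_eq_prod_map_map (by fun_prop) (by fun_prop)] at h1 h2 hAN ⊢
  have := Measure.isProbabilityMeasure_map (μ := P) hA.aemeasurable
  have := Measure.isProbabilityMeasure_map (μ := P) hN.aemeasurable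
  have := Measure.isProbabilityMeasure_map (μ := P) hO.aemeasurable
  rw [hAN, ← MeasurableEquiv.prodAssoc.map_measurableEquiv_injective.eq_iff,
    Measure.prodAssoc_prod, ← h2, ← h1, Measure.map_map (by fun_prop) (by fun_prop)]
  rfl

/-- Used with A the parent data, N the cluster sizes and O the displacements: the sizes factor out
and the displacements are averaged for fixed parents. -/
theorem lintegral_mul_of_indepFun_prodMk {A : Ω → α} {N : Ω → β} {O : Ω → γ} (hA : Measurable A)
    (hN : Measurable N) (hO : Measurable O) (h1 : IndepFun A (fun ω => (N ω, O ω)) P)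
    (h2 : IndepFun N O P) {u : β → ℝ≥0∞} (hu : Measurable u) {G : α → γ → ℝ≥0∞}
    (hG : Measurable (Function.uncurry G)) :
    ∫⁻ ω, u (N ω) * G (A ω) (O ω) ∂P =
      (∫⁻ ω, u (N ω) ∂P) * ∫⁻ ω, ∫⁻ z, G (A ω) z ∂(P.map O) ∂P := by
  have := Measure.isProbabilityMeasure_map (μ := P) hA.aemeasurable
  have := Measure.isProbabilityMeasure_map (μ := P) hN.aemeasurable
  have := Measure.isProbabilityMeasure_map (μ := P) hO.aemeasurable
  rw [indepFun_iff_map_prod_eq_prod_map_map (by fun_prop) (by fun_prop)] at h1 h2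
  rw [h2] at h1
  have hm : Measurable fun z : α × β × γ => u z.2.1 * G z.1 z.2.2 :=
    (hu.comp (by fun_prop)).mul (hG.comp (g := Function.uncurry G)
      (f := fun z : α × β × γ => (z.1, z.2.2)) (by fun_prop))
  have hi : Measurable fun a => ∫⁻ z, G a z ∂(P.map O) := hG.lintegral_prod_right'
  calc ∫⁻ ω, u (N ω) * G (A ω) (O ω) ∂P
      = ∫⁻ z, u z.2.1 * G z.1 z.2.2 ∂(P.map fun ω => (A ω, N ω, O ω)) := by
        rw [lintegral_map hm (by fun_prop)]
    _ = ∫⁻ a, (∫⁻ n, u n ∂(P.map N)) * ∫⁻ z, G a z ∂(P.map O) ∂(P.map A) := by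
        rw [h1, lintegral_prod _ hm.aemeasurable]
        refine lintegral_congr fun a => ?_
        exact lintegral_prod_mul hu.aemeasurable
          (hG.comp (measurable_const.prodMk measurable_id)).aemeasurable
    _ = _ := by rw [lintegral_const_mul _ hi, lintegral_map hu hN, lintegral_map hi hA]

end Independence

theorem tsum_ite_lt (n : ℕ) : ∑' k, (if k < n then 1 else 0 : ℝ≥0∞) = n := by
  rw [tsum_eq_sum (s := Finset.range n) (by simp_all)]
  rw [Finset.sum_congr rfl fun k hk => if_pos (Finset.mem_range.1 hk)]
  simp

section PoissonNumber

variable {Ω : Type*} [MeasurableSpace Ω] {P : Measure Ω}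

theorem tsum_lintegral_ite_lt {N : Ω → ℕ} {c : ℝ≥0} (hN : Measurable N)
    (h : HasLaw N (poissonMeasure c) P) :
    ∑' k, ∫⁻ ω, (if k < N ω then 1 else 0 : ℝ≥0∞) ∂P = c := by
  have mw (k : ℕ) : Measurable fun ω => (if k < N ω then 1 else 0 : ℝ≥0∞) :=
    (Measurable.of_discrete (f := fun n : ℕ => (if k < n then 1 else 0 : ℝ≥0∞))).comp hN
  rw [← lintegral_tsum fun k => (mw k).aemeasurable]
  simp_rw [tsum_ite_lt]
  rw [h.lintegral_comp (f := fun n : ℕ => (n : ℝ≥0∞)) (by fun_prop),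
    lintegral_natCast_poissonMeasure]

theorem measurable_ite_lt_mul {N N' : Ω → ℕ} (hN : Measurable N) (hN' : Measurable N') (k l : ℕ) :
    Measurable fun ω => ((if k < N ω then 1 else 0) * (if l < N' ω then 1 else 0) : ℝ≥0∞) :=
  ((Measurable.of_discrete (f := fun n : ℕ => (if k < n then 1 else 0 : ℝ≥0∞))).comp hN).mul
    ((Measurable.of_discrete (f := fun n : ℕ => (if l < n then 1 else 0 : ℝ≥0∞))).comp hN')

theorem tsum_tsum_lintegral_ite_lt {N N' : Ω → ℕ} (hN : Measurable N) (hN' : Measurable N') :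
    ∑' k, ∑' l, ∫⁻ ω, ((if k < N ω then 1 else 0) * (if l < N' ω then 1 else 0) : ℝ≥0∞) ∂P =
      ∫⁻ ω, (N ω : ℝ≥0∞) * N' ω ∂P := by
  have h (k l) := measurable_ite_lt_mul hN hN' k l
  simp_rw [← fun k => lintegral_tsum fun l => (h k l).aemeasurable (μ := P)]
  rw [← lintegral_tsum fun k => (Measurable.tsum fun l => h k l).aemeasurable]
  simp_rw [ENNReal.tsum_mul_left, tsum_ite_lt, ENNReal.tsum_mul_right, tsum_ite_lt]

theorem tsum_tsum_lintegral_ite_lt_of_indepFun {N N' : Ω → ℕ} {c : ℝ≥0} (hN : Measurable N)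
    (hN' : Measurable N') (h : HasLaw N (poissonMeasure c) P) (h' : HasLaw N' (poissonMeasure c) P)
    (hi : IndepFun N N' P) :
    ∑' k, ∑' l, ∫⁻ ω, ((if k < N ω then 1 else 0) * (if l < N' ω then 1 else 0) : ℝ≥0∞) ∂P =
      (c : ℝ≥0∞) ^ 2 := by
  rw [tsum_tsum_lintegral_ite_lt hN hN']
  have := lintegral_mul_eq_lintegral_mul_lintegral_of_indepFun (μ := P)
    (f := fun ω => (N ω : ℝ≥0∞)) (g := fun ω => (N' ω : ℝ≥0∞)) (by fun_prop) (by fun_prop)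
    (hi.comp (φ := fun n : ℕ => (n : ℝ≥0∞)) (ψ := fun n : ℕ => (n : ℝ≥0∞))
      (by fun_prop) (by fun_prop))
  simp only [Pi.mul_apply] at this
  rw [this, h.lintegral_comp (f := fun n : ℕ => (n : ℝ≥0∞)) (by fun_prop),
    h'.lintegral_comp (f := fun n : ℕ => (n : ℝ≥0∞)) (by fun_prop),
    lintegral_natCast_poissonMeasure, sq]

/-- This is the second factorial moment of the cluster size. The diagonal terms sum to the mean `c`,
which is finite and can be cancelled from E[N²] = c² + c. -/
theorem tsum_tsum_lintegral_ite_lt_offDiag {N : Ω → ℕ} {c : ℝ≥0} (hN : Measurable N)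
    (h : HasLaw N (poissonMeasure c) P) :
    ∑' k, ∑' l, (if l = k then 0 else
      ∫⁻ ω, ((if k < N ω then 1 else 0) * (if l < N ω then 1 else 0) : ℝ≥0∞) ∂P) =
      (c : ℝ≥0∞) ^ 2 := by
  have h1 := tsum_tsum_lintegral_ite_lt (P := P) hN hN
  rw [h.lintegral_comp (f := fun n : ℕ => (n : ℝ≥0∞) * n) (by fun_prop),
    lintegral_natCast_sq_poissonMeasure, ← sq] at h1
  rw [← ENNReal.add_left_inj (ENNReal.coe_ne_top (r := c)), ← h1]
  nth_rw 1 [← tsum_lintegral_ite_lt hN h]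
  rw [← ENNReal.tsum_add]
  refine tsum_congr fun k => ?_
  rw [← tsum_ite_eq k fun _ => ∫⁻ ω, (if k < N ω then 1 else 0 : ℝ≥0∞) ∂P, ← ENNReal.tsum_add]
  refine tsum_congr fun l => ?_
  by_cases hl : l = k
  · subst hl
    simp only [if_true, zero_add]
    exact lintegral_congr fun ω => by split_ifs <;> simp
  · simp [hl]

end PoissonNumber

/-- Moments of the random set of those points `X p` for which the weight `K p` is `1` (and not `0`):
the intensity is `lam`, and the sums over pairs of points exceed those of a Poisson process by
a contribution `Q` that is bounded by `B` times Lebesgue measure. -/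
structure HasPairMoments {Ω ι : Type*} [MeasurableSpace Ω] (K : ι → Ω → ℝ≥0∞) (X : ι → Ω → Plane)
    (P : Measure Ω) (lam : ℝ≥0∞) (Q : (Plane × Plane → ℝ≥0∞) → ℝ≥0∞) (B : ℝ≥0∞) : Prop where
  measurable_weight : ∀ p, Measurable (K p)
  measurable_point : ∀ p, Measurable (X p)
  weight : ∀ p ω, K p ω = 0 ∨ K p ω = 1
  first : ∀ φ : Plane → ℝ≥0∞, Measurable φ →
    ∑' p, ∫⁻ ω, K p ω * φ (X p ω) ∂P = lam * ∫⁻ x, φ x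
  second : ∀ F : Plane × Plane → ℝ≥0∞, Measurable F →
    ∑' p, ∑' q, ∫⁻ ω, K p ω * K q ω * F (X p ω, X q ω) ∂P =
      lam ^ 2 * (∫⁻ x, ∫⁻ y, F (x, y)) + Q F + lam * ∫⁻ x, F (x, x)
  bound : ∀ F : Plane × Plane → ℝ≥0∞, Measurable F → Q F ≤ B * ∫⁻ x, ∫⁻ y, F (x, y)

theorem IsPoissonProcess.hasPairMoments {Ω : Type*} [MeasurableSpace Ω] {P : Measure Ω}
    {Z : ℕ → Ω → Plane} {lam : ℝ≥0∞} [SigmaFinite (lam • (volume : Measure Plane))]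
    (hZ : IsPoissonProcess Z (lam • volume) P) :
    HasPairMoments (fun _ _ => 1) Z P lam (fun _ => 0) 0 where
  measurable_weight _ := measurable_const
  measurable_point := hZ.measurable
  weight _ _ := Or.inr rfl
  first φ hφ := by simpa using hZ.tsum_lintegral hφ
  second F hF := by
    have h : Measurable fun x => ∫⁻ y, F (x, y) := hF.lintegral_prod_right'
    have := hZ.tsum_tsum_lintegral hF
    simp only [lintegral_smul_measure, smul_eq_mul] at this
    rw [lintegral_const_mul _ h] at this
    simpa [sq, mul_assoc] using this
  bound F hF := by simp

/-! ### Averaging over random displacements -/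

section Displacement

variable {ρ : Measure Plane}

theorem lintegral_lintegral_add [IsProbabilityMeasure ρ] {φ : Plane → ℝ≥0∞} (hφ : Measurable φ) :
    ∫⁻ x, ∫⁻ u, φ (x + u) ∂ρ = ∫⁻ x, φ x := by
  rw [lintegral_lintegral_swap (by fun_prop)]
  simp_rw [lintegral_add_right_eq_self]
  simp

/-- Lebesgue measure on pairs is invariant under each fixed translation, hence under averaging over
random ones. -/
theorem lintegral_lintegral_lintegral_add_add [IsProbabilityMeasure ρ]
    {F : Plane × Plane → ℝ≥0∞} (hF : Measurable F) :
    ∫⁻ x, ∫⁻ y, ∫⁻ z, F (x + z.1, y + z.2) ∂(ρ.prod ρ) = ∫⁻ x, ∫⁻ y, F (x, y) := by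
  rw [lintegral_lintegral (f := fun x y => ∫⁻ z, F (x + z.1, y + z.2) ∂(ρ.prod ρ)) (by
      apply Measurable.aemeasurable
      apply Measurable.lintegral_prod_right'
        (f := fun w : (Plane × Plane) × (Plane × Plane) => F (w.1.1 + w.2.1, w.1.2 + w.2.2))
      fun_prop), lintegral_lintegral_swap (by fun_prop)]
  have h (z : Plane × Plane) : ∫⁻ w : Plane × Plane, F (w.1 + z.1, w.2 + z.2) =
      ∫⁻ w : Plane × Plane, F w :=
    lintegral_add_right_eq_self (μ := (volume : Measure Plane).prod volume) F z
  refine (lintegral_congr h).trans ?_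
  rw [lintegral_const, measure_univ, mul_one]
  exact lintegral_prod _ hF.aemeasurable

/-- Controls pairs of siblings. The law of the second displacement is replaced by `b` times Lebesgue
measure, which makes the second point independent of the parent; the first displacement is then
averaged away by translation invariance. -/
theorem lintegral_lintegral_add_add_le [IsProbabilityMeasure ρ] {b : ℝ≥0∞} (hρ : ρ ≤ b • volume)
    {F : Plane × Plane → ℝ≥0∞} (hF : Measurable F) :
    ∫⁻ x, ∫⁻ z, F (x + z.1, x + z.2) ∂(ρ.prod ρ) ≤ b * ∫⁻ x, ∫⁻ y, F (x, y) := by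
  have hF' : Measurable fun x => ∫⁻ y, F (x, y) := hF.lintegral_prod_right'
  calc ∫⁻ x, ∫⁻ z, F (x + z.1, x + z.2) ∂(ρ.prod ρ)
      = ∫⁻ x, ∫⁻ u, ∫⁻ v, F (x + u, x + v) ∂ρ ∂ρ := by
        refine lintegral_congr fun x => ?_
        rw [lintegral_prod _ (by fun_prop)]
    _ ≤ ∫⁻ x, ∫⁻ u, (b * ∫⁻ y, F (x + u, y)) ∂ρ := by
        refine lintegral_mono fun x => lintegral_mono fun u => ?_
        refine (lintegral_mono' hρ le_rfl).trans_eq ?_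
        rw [lintegral_smul_measure, smul_eq_mul,
          lintegral_add_left_eq_self (fun y => F (x + u, y)) x]
    _ = b * ∫⁻ x, ∫⁻ y, F (x, y) := by
        rw [lintegral_lintegral_add (hF'.const_mul b), lintegral_const_mul _ hF']

end Displacement

namespace HasPairMoments

variable {Ω ι : Type*} [MeasurableSpace Ω] {K : ι → Ω → ℝ≥0∞} {X : ι → Ω → Plane}
  {P : Measure Ω} {lam B : ℝ≥0∞} {Q : (Plane × Plane → ℝ≥0∞) → ℝ≥0∞}

theorem weight_mul_self (hm : HasPairMoments K X P lam Q B) (p : ι) (ω : Ω) :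
    K p ω * K p ω = K p ω := by
  rcases hm.weight p ω with h | h <;> simp [h]

theorem reindex {ι' : Type*} (e : ι' ≃ ι) (hm : HasPairMoments K X P lam Q B) :
    HasPairMoments (fun p => K (e p)) (fun p => X (e p)) P lam Q B where
  measurable_weight p := hm.measurable_weight _
  measurable_point p := hm.measurable_point _
  weight p := hm.weight _
  first φ hφ := by
    rw [← hm.first φ hφ]
    exact e.tsum_eq fun p => ∫⁻ ω, K p ω * φ (X p ω) ∂P
  second F hF := by
    rw [← hm.second F hF, ← e.tsum_eq]
    exact tsum_congr fun p => e.tsum_eq fun q =>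
      ∫⁻ ω, K (e p) ω * K q ω * F (X (e p) ω, X q ω) ∂P
  bound := hm.bound

/-- Replacing every point by a Poisson cluster with i.i.d. displacements preserves pair moments. -/
theorem cluster [Nonempty ι] [IsProbabilityMeasure P] (hm : HasPairMoments K X P lam Q B)
    {n : ι → Ω → ℕ} {o : ι → ℕ → Ω → Plane} {c : ℝ≥0} {ρ : Measure Plane} {b : ℝ≥0∞}
    (hρ : ρ ≤ b • volume) (mn : ∀ p, Measurable (n p)) (mo : ∀ p k, Measurable (o p k))
    (law_n : ∀ p, HasLaw (n p) (poissonMeasure c) P) (law_o : ∀ p k, HasLaw (o p k) ρ P)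
    (indep_n : iIndepFun n P) (indep_o : iIndepFun (fun p : ι × ℕ => o p.1 p.2) P)
    (indep_base : IndepFun (fun ω p => (K p ω, X p ω))
      (fun ω => ((fun p => n p ω), (fun p k => o p k ω))) P)
    (indep_n_o : IndepFun (fun ω p => n p ω) (fun ω p k => o p k ω) P) :
    ∃ Q', HasPairMoments (fun (p : ι × ℕ) ω => K p.1 ω * if p.2 < n p.1 ω then 1 else 0)
      (fun p ω => X p.1 ω + o p.1 p.2 ω) P (c * lam) Q' (c ^ 2 * (B + lam * b)) := by
  classical
  have mK := hm.measurable_weight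
  have mX := hm.measurable_point
  have mw (k : ℕ) : Measurable fun m : ℕ => (if k < m then 1 else 0 : ℝ≥0∞) := .of_discrete
  -- The average of F over independent displacements of both points, as a function of the two
  -- parents.
  let Ft (F : Plane × Plane → ℝ≥0∞) (w : Plane × Plane) : ℝ≥0∞ :=
    ∫⁻ z, F (w.1 + z.1, w.2 + z.2) ∂(ρ.prod ρ)
  obtain ⟨p₀⟩ := ‹Nonempty ι›
  -- `ρ` is the law of some displacement; this is where a label is needed.
  have : IsProbabilityMeasure ρ := by
    rw [← (law_o p₀ 0).map_eq]
    exact Measure.isProbabilityMeasure_map (mo p₀ 0).aemeasurable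
  have mFt {F : Plane × Plane → ℝ≥0∞} (hF : Measurable F) : Measurable (Ft F) := by
    apply Measurable.lintegral_prod_right'
      (f := fun w : (Plane × Plane) × (Plane × Plane) => F (w.1.1 + w.2.1, w.1.2 + w.2.2))
    fun_prop
  -- The new excess is the old one passed on to the daughters, plus the pairs of siblings, whose
  -- parents coincide.
  refine ⟨fun F => c ^ 2 * (Q (Ft F) + lam * ∫⁻ x, Ft F (x, x)), ?_, ?_, ?_, ?_, ?_, ?_⟩
  · intro p
    exact (mK p.1).mul ((mw p.2).comp (mn p.1))
  · intro p
    exact (mX p.1).add (mo p.1 p.2)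
  · intro p ω
    rcases hm.weight p.1 ω with h | h <;> by_cases h' : p.2 < n p.1 ω <;> simp [h, h']
  · -- first moment
    intro φ hφ
    have term (p : ι) (k : ℕ) :
        ∫⁻ ω, (K p ω * if k < n p ω then 1 else 0) * φ (X p ω + o p k ω) ∂P =
          (∫⁻ ω, (if k < n p ω then 1 else 0 : ℝ≥0∞) ∂P) *
            ∫⁻ ω, K p ω * ∫⁻ u, φ (X p ω + u) ∂ρ ∂P := by
      have := lintegral_mul_of_indepFun_prodMk (P := P) (A := fun ω => (K p ω, X p ω))
        (N := n p) (O := o p k) (u := fun m => if k < m then 1 else 0)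
        (G := fun a u => a.1 * φ (a.2 + u)) (by fun_prop) (mn p) (mo p k)
        (indep_base.comp (φ := fun a => a p) (ψ := fun z => (z.1 p, z.2 p k))
          (by fun_prop) (by fun_prop))
        (indep_n_o.comp (φ := fun a : ι → ℕ => a p) (ψ := fun z : ι → ℕ → Plane => z p k)
          (by fun_prop) (by fun_prop))
        (mw k) (by simp only [Function.uncurry_def]; fun_prop)
      rw [(law_o p k).map_eq] at this
      calc _ = _ := lintegral_congr fun ω => by ring
        _ = _ := this
        _ = _ := by
          congr 1
          exact lintegral_congr fun ω => lintegral_const_mul _ (by fun_prop)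
    have hφ' : Measurable fun x => ∫⁻ u, φ (x + u) ∂ρ :=
      Measurable.lintegral_prod_right' (f := fun z : Plane × Plane => φ (z.1 + z.2)) (by fun_prop)
    rw [ENNReal.tsum_prod']
    simp_rw [term, ENNReal.tsum_mul_right, tsum_lintegral_ite_lt (mn _) (law_n _)]
    rw [ENNReal.tsum_mul_left, hm.first _ hφ', lintegral_lintegral_add hφ, mul_assoc]
  · -- second moment
    intro F hF
    -- Distinct labels have independent displacements. The case p = q with k ≠ l is included, and
    -- there the two sizes are the same variable.
    have off (p q : ι) (k l : ℕ) (hne : (p, k) ≠ (q, l)) :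
        ∫⁻ ω, (K p ω * if k < n p ω then 1 else 0) * (K q ω * if l < n q ω then 1 else 0) *
          F (X p ω + o p k ω, X q ω + o q l ω) ∂P =
        (∫⁻ ω, ((if k < n p ω then 1 else 0) * (if l < n q ω then 1 else 0) : ℝ≥0∞) ∂P) *
          ∫⁻ ω, K p ω * K q ω * Ft F (X p ω, X q ω) ∂P := by
      have := lintegral_mul_of_indepFun_prodMk (P := P)
        (A := fun ω => ((K p ω, X p ω), (K q ω, X q ω)))
        (N := fun ω => (n p ω, n q ω)) (O := fun ω => (o p k ω, o q l ω))
        (u := fun m => (if k < m.1 then 1 else 0) * (if l < m.2 then 1 else 0))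
        (G := fun a u => a.1.1 * a.2.1 * F (a.1.2 + u.1, a.2.2 + u.2))
        (by fun_prop) (by fun_prop) (by fun_prop)
        (indep_base.comp (φ := fun a => (a p, a q))
          (ψ := fun z => ((z.1 p, z.1 q), (z.2 p k, z.2 q l))) (by fun_prop) (by fun_prop))
        (indep_n_o.comp (φ := fun a => (a p, a q)) (ψ := fun z => (z p k, z q l))
          (by fun_prop) (by fun_prop))
        .of_discrete (by simp only [Function.uncurry_def]; fun_prop)
      have hO : P.map (fun ω => (o p k ω, o q l ω)) = ρ.prod ρ := by
        have h := indep_o.indepFun hne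
        rw [indepFun_iff_map_prod_eq_prod_map_map (mo p k).aemeasurable (mo q l).aemeasurable,
          (law_o p k).map_eq, (law_o q l).map_eq] at h
        exact h
      rw [hO] at this
      calc _ = _ := lintegral_congr fun ω => by ring
        _ = _ := this
        _ = _ := by
          congr 1
          exact lintegral_congr fun ω => lintegral_const_mul _ (by fun_prop)
    have diag (p : ι) (k : ℕ) :
        ∫⁻ ω, (K p ω * if k < n p ω then 1 else 0) * (K p ω * if k < n p ω then 1 else 0) *
          F (X p ω + o p k ω, X p ω + o p k ω) ∂P =
        (∫⁻ ω, (if k < n p ω then 1 else 0 : ℝ≥0∞) ∂P) *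
          ∫⁻ ω, K p ω * ∫⁻ u, F (X p ω + u, X p ω + u) ∂ρ ∂P := by
      have := lintegral_mul_of_indepFun_prodMk (P := P) (A := fun ω => (K p ω, X p ω))
        (N := n p) (O := o p k) (u := fun m => if k < m then 1 else 0)
        (G := fun a u => a.1 * F (a.2 + u, a.2 + u)) (by fun_prop) (mn p) (mo p k)
        (indep_base.comp (φ := fun a => a p) (ψ := fun z => (z.1 p, z.2 p k))
          (by fun_prop) (by fun_prop))
        (indep_n_o.comp (φ := fun a : ι → ℕ => a p) (ψ := fun z : ι → ℕ → Plane => z p k)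
          (by fun_prop) (by fun_prop))
        (mw k) (by simp only [Function.uncurry_def]; fun_prop)
      rw [(law_o p k).map_eq] at this
      calc _ = _ := lintegral_congr fun ω => by
              rw [mul_mul_mul_comm, hm.weight_mul_self]
              split_ifs <;> simp
        _ = _ := this
        _ = _ := by
          congr 1
          exact lintegral_congr fun ω => lintegral_const_mul _ (by fun_prop)
    set D : ι → ℝ≥0∞ := fun p => ∫⁻ ω, K p ω * ∫⁻ u, F (X p ω + u, X p ω + u) ∂ρ ∂P with hD
    -- Here the Poisson law matters: distinct siblings (p = q, k ≠ l) carry the factor c², exactly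
    -- as daughters of different parents do. Only the term of a daughter with itself is extra.
    have pair (p q : ι) : ∑' k, ∑' l,
        ∫⁻ ω, (K p ω * if k < n p ω then 1 else 0) * (K q ω * if l < n q ω then 1 else 0) *
          F (X p ω + o p k ω, X q ω + o q l ω) ∂P =
        c ^ 2 * ∫⁻ ω, K p ω * K q ω * Ft F (X p ω, X q ω) ∂P +
          if q = p then c * D p else 0 := by
      by_cases hqp : q = p
      · subst hqp
        rw [if_pos rfl, ← tsum_tsum_lintegral_ite_lt_offDiag (mn q) (law_n q),
          ← tsum_lintegral_ite_lt (mn q) (law_n q), ← ENNReal.tsum_mul_right,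
          ← ENNReal.tsum_mul_right, ← ENNReal.tsum_add]
        refine tsum_congr fun k => ?_
        rw [← tsum_ite_eq k fun _ => (∫⁻ ω, (if k < n q ω then 1 else 0 : ℝ≥0∞) ∂P) * D q,
          ← ENNReal.tsum_mul_right, ← ENNReal.tsum_add]
        refine tsum_congr fun l => ?_
        by_cases hl : l = k
        · subst hl
          simp only [if_true, zero_mul, zero_add]
          exact diag q l
        · simp only [if_neg hl, add_zero]
          exact off q q k l fun h => hl (Prod.mk.inj h).2.symm
      · rw [if_neg hqp, add_zero, ← tsum_tsum_lintegral_ite_lt_of_indepFun (mn p) (mn q) (law_n p)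
          (law_n q) (indep_n.indepFun (Ne.symm hqp))]
        simp_rw [← ENNReal.tsum_mul_right]
        exact tsum_congr fun k => tsum_congr fun l =>
          off p q k l fun h => hqp (Prod.mk.inj h).1.symm
    have hDF : Measurable fun x => ∫⁻ u, F (x + u, x + u) ∂ρ :=
      Measurable.lintegral_prod_right'
        (f := fun z : Plane × Plane => F (z.1 + z.2, z.1 + z.2)) (by fun_prop)
    calc _ = ∑' p, ∑' q, (c ^ 2 * ∫⁻ ω, K p ω * K q ω * Ft F (X p ω, X q ω) ∂P +
          if q = p then c * D p else 0) := by
          simp_rw [ENNReal.tsum_prod']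
          refine tsum_congr fun p => ?_
          -- The sums over k and q are exchanged, so that all daughters of a fixed pair of parents
          -- are summed together.
          rw [ENNReal.tsum_comm]
          exact tsum_congr fun q => pair p q
      _ = c ^ 2 * (lam ^ 2 * (∫⁻ x, ∫⁻ y, F (x, y)) + Q (Ft F) + lam * ∫⁻ x, Ft F (x, x)) +
          c * (lam * ∫⁻ x, F (x, x)) := by
          simp_rw [ENNReal.tsum_add, tsum_ite_eq, ENNReal.tsum_mul_left]
          rw [hm.second _ (mFt hF), hm.first _ hDF,
            lintegral_lintegral_add (φ := fun x => F (x, x)) (by fun_prop),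
            lintegral_lintegral_lintegral_add_add hF]
      _ = _ := by ring
  · intro F hF
    calc _ ≤ c ^ 2 * (B * (∫⁻ x, ∫⁻ y, Ft F (x, y)) + lam * (b * ∫⁻ x, ∫⁻ y, F (x, y))) := by
          gcongr
          · exact hm.bound _ (mFt hF)
          · exact lintegral_lintegral_add_add_le hρ hF
      _ = _ := by
          rw [lintegral_lintegral_lintegral_add_add hF]
          ring

end HasPairMoments

/-! ### Integrals of the path loss -/

section PathLoss

variable {α ε : ℝ}

@[fun_prop]
theorem measurable_pathLoss : Measurable (pathLoss α ε) := by
  unfold pathLoss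
  fun_prop

theorem pathLoss_pos (hε : 0 < ε) (x : Plane) : 0 < pathLoss α ε x := by
  unfold pathLoss
  positivity

theorem pathLoss_le (hε : 0 < ε) (x : Plane) : pathLoss α ε x ≤ 1 / ε := by
  unfold pathLoss
  exact one_div_le_one_div_of_le hε (le_add_of_nonneg_right (by positivity))

/-- Comparison with (1 + |x|)^(-α), which is integrable in dimension 2 because α > 2. -/
theorem integrable_pathLoss (hα : 2 < α) (hε : 0 < ε) : Integrable (pathLoss α ε) := by
  have h : Integrable fun x : Plane => 2 ^ α * max 1 (1 / ε) * (1 + ‖x‖) ^ (-α) :=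
    (integrable_one_add_norm (by simpa using hα)).const_mul _
  refine h.mono' (by fun_prop) (.of_forall fun x => ?_)
  rw [Real.norm_of_nonneg (pathLoss_pos hε x).le, Real.rpow_neg (by positivity),
    ← div_eq_mul_inv, pathLoss, div_le_div_iff₀ (by positivity) (by positivity), one_mul]
  have h1 : (1 + ‖x‖) ^ α ≤ 2 ^ α * (1 + ‖x‖ ^ α) := by
    rcases le_total ‖x‖ 1 with hx | hx
    · calc (1 + ‖x‖) ^ α ≤ 2 ^ α := by gcongr; linarith
        _ ≤ 2 ^ α * (1 + ‖x‖ ^ α) :=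
          le_mul_of_one_le_right (by positivity) (le_add_of_nonneg_right (by positivity))
    · calc (1 + ‖x‖) ^ α ≤ (2 * ‖x‖) ^ α := by gcongr; linarith
        _ = 2 ^ α * ‖x‖ ^ α := Real.mul_rpow (by norm_num) (by positivity)
        _ ≤ 2 ^ α * (1 + ‖x‖ ^ α) := by gcongr; linarith
  have h2 : 1 + ‖x‖ ^ α ≤ max 1 (1 / ε) * (ε + ‖x‖ ^ α) := by
    rw [mul_add]
    gcongr ?_ + ?_
    · calc (1 : ℝ) = 1 / ε * ε := by field_simp
        _ ≤ _ := by gcongr; exact le_max_right _ _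
    · exact le_mul_of_one_le_left (by positivity) (le_max_left _ _)
  calc (1 + ‖x‖) ^ α ≤ 2 ^ α * (1 + ‖x‖ ^ α) := h1
    _ ≤ 2 ^ α * (max 1 (1 / ε) * (ε + ‖x‖ ^ α)) := by gcongr
    _ = _ := by ring

theorem integrable_pathLoss_mul (hα : 2 < α) (hε : 0 < ε) (V : Plane) :
    Integrable fun x => pathLoss α ε x * pathLoss α ε (x + V) := by
  refine ((integrable_pathLoss hα hε).mul_const (1 / ε)).mono' (by fun_prop) (.of_forall fun x => ?_)
  rw [Real.norm_of_nonneg (mul_nonneg (pathLoss_pos hε _).le (pathLoss_pos hε _).le)]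
  exact mul_le_mul_of_nonneg_left (pathLoss_le hε _) (pathLoss_pos hε _).le

theorem integrable_pathLoss_sq (hα : 2 < α) (hε : 0 < ε) :
    Integrable fun x => pathLoss α ε x ^ 2 := by
  simpa [sq] using integrable_pathLoss_mul hα hε 0

theorem integral_pathLoss_pos (hα : 2 < α) (hε : 0 < ε) : 0 < ∫ x, pathLoss α ε x := by
  rw [integral_pos_iff_support_of_nonneg (fun x => (pathLoss_pos hε x).le)
    (integrable_pathLoss hα hε), Function.support_eq_univ fun x => (pathLoss_pos hε x).ne']
  simp

theorem integral_pathLoss_sq_pos (hα : 2 < α) (hε : 0 < ε) : 0 < ∫ x, pathLoss α ε x ^ 2 := by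
  rw [integral_pos_iff_support_of_nonneg (fun x => by positivity)
    (integrable_pathLoss_sq hα hε),
    Function.support_eq_univ fun x => (pow_pos (pathLoss_pos hε x) 2).ne']
  simp

/-! ### Scaling in ε and the limits of the normalised integrals -/

theorem pathLoss_smul (hα : 2 < α) (hε : 0 < ε) (x : Plane) :
    pathLoss α ε (ε ^ α⁻¹ • x) = ε⁻¹ * pathLoss α 1 x := by
  have h : (ε ^ α⁻¹) ^ α = ε := Real.rpow_inv_rpow hε.le (by linarith)
  simp only [pathLoss]
  rw [norm_smul, Real.norm_of_nonneg (by positivity), Real.mul_rpow (by positivity) (by positivity),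
    h]
  field_simp

theorem integral_pathLoss (hα : 2 < α) (hε : 0 < ε) :
    ∫ x, pathLoss α ε x = (ε ^ α⁻¹) ^ 2 * ε⁻¹ * ∫ x, pathLoss α 1 x := by
  have h := Measure.integral_comp_smul (volume : Measure Plane) (pathLoss α ε) (ε ^ α⁻¹)
  simp_rw [pathLoss_smul hα hε, integral_const_mul] at h
  have hs : 0 < (ε ^ α⁻¹) ^ 2 := by positivity
  rw [finrank_euclideanSpace_fin, abs_of_pos (by positivity), smul_eq_mul,
    eq_inv_mul_iff_mul_eq₀ hs.ne'] at h
  rw [← h, mul_assoc]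

theorem integral_pathLoss_sq (hα : 2 < α) (hε : 0 < ε) :
    ∫ x, pathLoss α ε x ^ 2 = (ε ^ α⁻¹) ^ 2 * ε⁻¹ ^ 2 * ∫ x, pathLoss α 1 x ^ 2 := by
  have h := Measure.integral_comp_smul (volume : Measure Plane) (fun x => pathLoss α ε x ^ 2)
    (ε ^ α⁻¹)
  simp_rw [pathLoss_smul hα hε, mul_pow, integral_const_mul] at h
  have hs : 0 < (ε ^ α⁻¹) ^ 2 := by positivity
  rw [finrank_euclideanSpace_fin, abs_of_pos (by positivity), smul_eq_mul,
    eq_inv_mul_iff_mul_eq₀ hs.ne'] at h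
  rw [← h, mul_assoc]

/-- By scaling the quotient is a constant times ε^(2/α). -/
theorem tendsto_integral_pathLoss_sq_div (hα : 2 < α) :
    Tendsto (fun ε => (∫ x, pathLoss α ε x) ^ 2 / ∫ x, pathLoss α ε x ^ 2) (𝓝[>] 0) (𝓝 0) := by
  have h : Tendsto (fun ε : ℝ => (ε ^ α⁻¹) ^ 2 * ((∫ x, pathLoss α 1 x) ^ 2 /
      ∫ x, pathLoss α 1 x ^ 2)) (𝓝[>] 0) (𝓝 0) := by
    have : ContinuousAt (fun ε : ℝ => (ε ^ α⁻¹) ^ 2 * ((∫ x, pathLoss α 1 x) ^ 2 /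
      ∫ x, pathLoss α 1 x ^ 2)) 0 :=
      ((Real.continuousAt_rpow_const _ _ (.inr (by positivity))).pow 2).mul_const _
    have h0 := this.tendsto.mono_left (nhdsWithin_le_nhds (s := Set.Ioi 0))
    rwa [Real.zero_rpow (by positivity), zero_pow two_ne_zero, zero_mul] at h0
  refine h.congr' ?_
  filter_upwards [self_mem_nhdsWithin] with ε hε
  have hε : 0 < ε := hε
  have := (integral_pathLoss_sq_pos hα one_pos).ne'
  rw [integral_pathLoss hα hε, integral_pathLoss_sq hα hε]
  field_simp

/-- By scaling the quotient is a constant times ε. -/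
theorem tendsto_integral_pathLoss_div (hα : 2 < α) :
    Tendsto (fun ε => (∫ x, pathLoss α ε x) / ∫ x, pathLoss α ε x ^ 2) (𝓝[>] 0) (𝓝 0) := by
  have h : Tendsto (fun ε : ℝ => ε * ((∫ x, pathLoss α 1 x) / ∫ x, pathLoss α 1 x ^ 2))
      (𝓝[>] 0) (𝓝 0) := by
    have h0 := (tendsto_id (x := 𝓝 (0 : ℝ))).mono_left (nhdsWithin_le_nhds (s := Set.Ioi 0))
    simpa using h0.mul_const ((∫ x, pathLoss α 1 x) / ∫ x, pathLoss α 1 x ^ 2)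
  refine h.congr' ?_
  filter_upwards [self_mem_nhdsWithin] with ε hε
  have hε : 0 < ε := hε
  have := (integral_pathLoss_sq_pos hα one_pos).ne'
  rw [integral_pathLoss hα hε, integral_pathLoss_sq hα hε]
  field_simp

theorem pathLoss_le_of_le_norm (hα : 0 < α) (hε : 0 < ε) {r : ℝ} (hr : 0 < r) {x : Plane}
    (hx : r ≤ ‖x‖) : pathLoss α ε x ≤ 1 / r ^ α := by
  unfold pathLoss
  apply one_div_le_one_div_of_le (by positivity)
  have : r ^ α ≤ ‖x‖ ^ α := by gcongr
  linarith

/-- At every x one of |x| and |x + V| is at least |V|/2, so one of the two factors is bounded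
uniformly in ε. -/
theorem integral_pathLoss_mul_le (hα : 2 < α) (hε : 0 < ε) {V : Plane} (hV : V ≠ 0) :
    ∫ x, pathLoss α ε x * pathLoss α ε (x + V) ≤
      2 * (1 / (‖V‖ / 2) ^ α) * ∫ x, pathLoss α ε x := by
  have hr : 0 < ‖V‖ / 2 := by positivity
  set C := 1 / (‖V‖ / 2) ^ α
  have hi := integrable_pathLoss hα hε
  have hi' : Integrable fun x => pathLoss α ε (x + V) := hi.comp_add_right V
  calc ∫ x, pathLoss α ε x * pathLoss α ε (x + V)
      ≤ ∫ x, (C * pathLoss α ε x + C * pathLoss α ε (x + V)) := by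
        refine integral_mono (integrable_pathLoss_mul hα hε V)
          ((hi.const_mul C).add (hi'.const_mul C)) fun x => ?_
        have p1 := (pathLoss_pos (α := α) hε x).le
        have p2 := (pathLoss_pos (α := α) hε (x + V)).le
        have hC : 0 ≤ C := by positivity
        rcases le_total (‖V‖ / 2) ‖x‖ with h | h
        · have := pathLoss_le_of_le_norm (by linarith : 0 < α) hε hr h
          exact (mul_le_mul_of_nonneg_right this p2).trans (le_add_of_nonneg_left (by positivity))
        · have h3 : ‖V‖ / 2 ≤ ‖x + V‖ := by
            have := norm_sub_le (x + V) x
            rw [add_sub_cancel_left] at this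
            linarith
          have := pathLoss_le_of_le_norm (by linarith : 0 < α) hε hr h3
          rw [mul_comm]
          exact (mul_le_mul_of_nonneg_right this p1).trans (le_add_of_nonneg_right (by positivity))
    _ = _ := by
        rw [integral_add (hi.const_mul C) (hi'.const_mul C), integral_const_mul,
          integral_const_mul, integral_add_right_eq_self (fun x => pathLoss α ε x) V]
        ring

theorem tendsto_div_integral_pathLoss_sq (hα : 2 < α) {C : ℝ} {κ : ℝ → ℝ}
    (h : ∀ ε, 0 < ε → |κ ε| ≤ C * (∫ x, pathLoss α ε x) ^ 2) :
    Tendsto (fun ε => κ ε / ∫ x, pathLoss α ε x ^ 2) (𝓝[>] 0) (𝓝 0) := by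
  have h0 := (tendsto_integral_pathLoss_sq_div hα).const_mul C
  rw [mul_zero] at h0
  refine squeeze_zero_norm' ?_ h0
  filter_upwards [self_mem_nhdsWithin] with ε hε
  have hb := integral_pathLoss_sq_pos hα hε
  rw [norm_div, Real.norm_of_nonneg hb.le, Real.norm_eq_abs, ← mul_div_assoc]
  gcongr
  exact h ε hε

open Classical in
theorem tendsto_integral_pathLoss_mul_div (hα : 2 < α) (V : Plane) :
    Tendsto (fun ε => (∫ x, pathLoss α ε x * pathLoss α ε (x + V)) / ∫ x, pathLoss α ε x ^ 2)
      (𝓝[>] 0) (𝓝 (if V = 0 then 1 else 0)) := by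
  split_ifs with hV
  · refine tendsto_const_nhds.congr' ?_
    filter_upwards [self_mem_nhdsWithin] with ε hε
    have hb := integral_pathLoss_sq_pos hα hε
    simp only [hV, add_zero, ← sq]
    rw [div_self hb.ne']
  · have h0 := (tendsto_integral_pathLoss_div hα).const_mul (2 * (1 / (‖V‖ / 2) ^ α))
    rw [mul_zero] at h0
    refine squeeze_zero' ?_ ?_ h0
    · filter_upwards [self_mem_nhdsWithin] with ε hε
      have hb := integral_pathLoss_sq_pos hα hε
      exact div_nonneg (integral_nonneg fun x =>
        (mul_pos (pathLoss_pos hε x) (pathLoss_pos hε _)).le) hb.le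
    · filter_upwards [self_mem_nhdsWithin] with ε hε
      have hb := integral_pathLoss_sq_pos hα hε
      rw [← mul_div_assoc]
      gcongr
      exact integral_pathLoss_mul_le hα hε hV

open Classical in
-- Dividing numerator and denominator by the integral of g_ε² kills κ. Applied with κ the clustering
-- term of the closed form.
theorem tendsto_covariance_div_variance (hα : 2 < α) (V : Plane) {C : ℝ} {κ : ℝ → ℝ}
    (h : ∀ ε, 0 < ε → |κ ε| ≤ C * (∫ x, pathLoss α ε x) ^ 2) :
    Tendsto (fun ε => ((∫ x, pathLoss α ε x * pathLoss α ε (x + V)) + κ ε) /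
      (2 * (∫ x, pathLoss α ε x ^ 2) + κ ε)) (𝓝[>] 0) (𝓝 (if V = 0 then 1 / 2 else 0)) := by
  have hκ := tendsto_div_integral_pathLoss_sq hα h
  have key := ((tendsto_integral_pathLoss_mul_div hα V).add hκ).div
    ((tendsto_const_nhds (x := (2 : ℝ))).add hκ) (by norm_num)
  have hlim : ((if V = 0 then 1 else 0) + 0) / (2 + 0 : ℝ) = if V = 0 then 1 / 2 else 0 := by
    split_ifs <;> norm_num
  rw [hlim] at key
  refine key.congr' ?_
  filter_upwards [self_mem_nhdsWithin] with ε hε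
  have hb := (integral_pathLoss_sq_pos hα hε).ne'
  rw [Pi.div_apply, ← add_div, ← mul_div_cancel_right₀ (2 : ℝ) hb, ← add_div,
    div_div_div_cancel_right₀ hb, mul_div_cancel_right₀ _ hb]

open Classical in
-- The version for the true correlation, with `a` the intensity. Three separate error terms are
-- allowed, so the excesses at different locations need not be compared with each other.
theorem tendsto_covariance_div_sqrt_variance (hα : 2 < α) (V : Plane) {a C : ℝ} (ha : 0 < a)
    {κ₀ κ₁ κ₂ : ℝ → ℝ} (h₀ : ∀ ε, 0 < ε → |κ₀ ε| ≤ C * (∫ x, pathLoss α ε x) ^ 2)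
    (h₁ : ∀ ε, 0 < ε → |κ₁ ε| ≤ C * (∫ x, pathLoss α ε x) ^ 2)
    (h₂ : ∀ ε, 0 < ε → |κ₂ ε| ≤ C * (∫ x, pathLoss α ε x) ^ 2) :
    Tendsto (fun ε => (a * (∫ x, pathLoss α ε x * pathLoss α ε (x + V)) + κ₀ ε) /
      (√(2 * a * (∫ x, pathLoss α ε x ^ 2) + κ₁ ε) *
        √(2 * a * (∫ x, pathLoss α ε x ^ 2) + κ₂ ε)))
      (𝓝[>] 0) (𝓝 (if V = 0 then 1 / 2 else 0)) := by
  have hd {κ : ℝ → ℝ} (h : ∀ ε, 0 < ε → |κ ε| ≤ C * (∫ x, pathLoss α ε x) ^ 2) :=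
    ((tendsto_const_nhds (x := 2 * a)).add (tendsto_div_integral_pathLoss_sq hα h)).sqrt
  have h2a : √(2 * a + 0) * √(2 * a + 0) = 2 * a := by
    rw [add_zero, Real.mul_self_sqrt (by positivity)]
  have key := (((tendsto_integral_pathLoss_mul_div hα V).const_mul a).add
    (tendsto_div_integral_pathLoss_sq hα h₀)).div ((hd h₁).mul (hd h₂)) (by rw [h2a]; positivity)
  have hlim : (a * (if V = 0 then 1 else 0) + 0) / (√(2 * a + 0) * √(2 * a + 0)) =
      if V = 0 then 1 / 2 else 0 := by
    rw [h2a]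
    split_ifs
    · field_simp
      simp
    · simp
  rw [hlim] at key
  refine key.congr' ?_
  filter_upwards [self_mem_nhdsWithin] with ε hε
  have hb := integral_pathLoss_sq_pos hα hε
  rw [Pi.div_apply, ← mul_div_assoc, ← add_div, ← mul_div_cancel_right₀ (2 * a) hb.ne', ← add_div,
    ← add_div, Real.sqrt_div' _ hb.le, Real.sqrt_div' _ hb.le, div_mul_div_comm,
    Real.mul_self_sqrt hb.le, div_div_div_cancel_right₀ hb.ne', mul_div_cancel_right₀ _ hb.ne']

/-! ### The clustering term -/

theorem measurable_diskOverlap (R : ℝ) : Measurable (diskOverlap R) := by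
  unfold diskOverlap
  refine Measurable.ite (measurableSet_le measurable_const measurable_id |>.inter
    (measurableSet_le measurable_id measurable_const)) ?_ measurable_const
  fun_prop

theorem abs_diskOverlap_le {R : ℝ} (hR : 0 < R) (r : ℝ) :
    |diskOverlap R r| ≤ 2 * R ^ 2 * Real.pi + 2 * R * R := by
  unfold diskOverlap
  split_ifs with h
  · refine (abs_sub _ _).trans ?_
    rw [abs_of_nonneg (by have := Real.arccos_nonneg (r / (2 * R)); positivity),
      abs_of_nonneg (mul_nonneg h.1 (Real.sqrt_nonneg _))]
    gcongr
    · exact Real.arccos_le_pi _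
    · exact h.2
    · rw [Real.sqrt_le_left hR.le]
      nlinarith [sq_nonneg r]
  · simp only [abs_zero]
    positivity

theorem abs_pathLoss_mul_diskOverlap_le (hε : 0 < ε) {R : ℝ} (hR : 0 < R) (z : Plane × Plane) :
    |pathLoss α ε z.1 * pathLoss α ε z.2 * diskOverlap R ‖z.1 - z.2‖| ≤
      pathLoss α ε z.1 * pathLoss α ε z.2 * (2 * R ^ 2 * Real.pi + 2 * R * R) := by
  have h := mul_nonneg (pathLoss_pos (α := α) hε z.1).le (pathLoss_pos (α := α) hε z.2).le
  rw [abs_mul, abs_of_nonneg h]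
  exact mul_le_mul_of_nonneg_left (abs_diskOverlap_le hR _) h

theorem integrable_pathLoss_mul_diskOverlap (hα : 2 < α) (hε : 0 < ε) {R : ℝ} (hR : 0 < R) :
    Integrable fun z : Plane × Plane =>
      pathLoss α ε z.1 * pathLoss α ε z.2 * diskOverlap R ‖z.1 - z.2‖ := by
  have hm := measurable_diskOverlap R
  exact (((integrable_pathLoss hα hε).mul_prod (integrable_pathLoss hα hε)).mul_const
    (2 * R ^ 2 * Real.pi + 2 * R * R)).mono' (by fun_prop)
    (.of_forall fun z => abs_pathLoss_mul_diskOverlap_le hε hR z)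

/-- Bounding the overlap area by a constant lets the double integral factor. -/
theorem abs_clusterTerm_le (hα : 2 < α) (hε : 0 < ε) {c R : ℝ} (hR : 0 < R) :
    |clusterTerm α ε c R| ≤ |c / (Real.pi ^ 2 * R ^ 4)| * (2 * R ^ 2 * Real.pi + 2 * R * R) *
      (∫ x, pathLoss α ε x) ^ 2 := by
  have hi := integrable_pathLoss hα hε
  rw [clusterTerm, abs_mul, mul_assoc]
  gcongr
  rw [← integral_prod (fun z : Plane × Plane =>
    pathLoss α ε z.1 * pathLoss α ε z.2 * diskOverlap R ‖z.1 - z.2‖)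
    (integrable_pathLoss_mul_diskOverlap hα hε hR)]
  have h := norm_integral_le_of_norm_le ((hi.mul_prod hi).mul_const
    (2 * R ^ 2 * Real.pi + 2 * R * R))
    (.of_forall fun z => (Real.norm_eq_abs _).trans_le (abs_pathLoss_mul_diskOverlap_le hε hR z))
  refine h.trans_eq ?_
  rw [integral_mul_const, integral_prod_mul]
  ring

end PathLoss

/-! ### Moments of the exponential distribution -/

/-- This is Euler's integral for Γ(n + 1). -/
theorem lintegral_pow_expMeasure (n : ℕ) :
    ∫⁻ s, ENNReal.ofReal s ^ n ∂(expMeasure 1) = n.factorial := by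
  have hm : Measurable (exponentialPDF 1) :=
    (measurable_exponentialPDFReal 1).ennreal_ofReal
  have h1 : ∫⁻ s, ENNReal.ofReal s ^ n ∂(expMeasure 1) =
      ∫⁻ s in Set.Ioi (0 : ℝ), ENNReal.ofReal (Real.exp (-s) * s ^ ((n + 1 : ℝ) - 1)) := by
    have : expMeasure 1 = volume.withDensity (exponentialPDF 1) := rfl
    rw [this, lintegral_withDensity_eq_lintegral_mul _ hm (by fun_prop), restrict_Ioi_eq_restrict_Ici,
      ← lintegral_indicator measurableSet_Ici]
    refine lintegral_congr fun s => ?_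
    rw [Pi.mul_apply, exponentialPDF_eq]
    by_cases hs : 0 ≤ s
    · rw [Set.indicator_of_mem (Set.mem_Ici.2 hs), if_pos hs, ← ENNReal.ofReal_pow hs,
        ← ENNReal.ofReal_mul (by positivity)]
      simp
    · rw [Set.indicator_of_notMem (by simpa using hs), if_neg hs]
      simp
  rw [h1, ← ofReal_integral_eq_lintegral_ofReal (Real.GammaIntegral_convergent (by positivity))
    (by
      filter_upwards [ae_restrict_mem measurableSet_Ioi] with s hs
      have : 0 < s := hs
      positivity), ← Real.Gamma_eq_integral (by positivity), Real.Gamma_nat_eq_factorial]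
  simp

theorem expMeasure_ae_nonneg : ∀ᵐ s ∂(expMeasure 1), 0 ≤ s := by
  have hm : Measurable (exponentialPDF 1) :=
    (measurable_exponentialPDFReal 1).ennreal_ofReal
  have : expMeasure 1 = volume.withDensity (exponentialPDF 1) := rfl
  rw [this, ae_withDensity_iff hm]
  refine .of_forall fun s hs => ?_
  by_contra h
  exact hs (exponentialPDF_of_neg (not_le.1 h))

theorem integral_pow_expMeasure (n : ℕ) : ∫ s, s ^ n ∂(expMeasure 1) = n.factorial := by
  rw [integral_eq_lintegral_of_nonneg_ae (expMeasure_ae_nonneg.mono fun s hs => by positivity)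
    (by fun_prop)]
  rw [← ENNReal.toReal_natCast, ← lintegral_pow_expMeasure n]
  congr 1
  exact lintegral_congr_ae (expMeasure_ae_nonneg.mono fun s hs => ENNReal.ofReal_pow hs n)

/-! ### Moments of the interference -/

namespace IsRayleighFading

variable {Ω ι β : Type*} [MeasurableSpace Ω] [MeasurableSpace β] {P : Measure Ω}
  {h : ι → Plane → ℕ → Ω → ℝ} {data : Ω → β}

theorem comp {γ : Type*} [MeasurableSpace γ] (hF : IsRayleighFading h data P) {f : β → γ}
    (hf : Measurable f) : IsRayleighFading h (fun ω => f (data ω)) P where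
  measurable := hF.measurable
  law := hF.law
  iIndep := hF.iIndep
  indep_data := hF.indep_data.comp measurable_id hf

theorem ae_nonneg (hF : IsRayleighFading h data P) (p : ι) (U : Plane) (t : ℕ) :
    ∀ᵐ ω ∂P, 0 ≤ h p U t ω := by
  have := expMeasure_ae_nonneg
  rw [← (hF.law p U t).map_eq] at this
  exact ae_of_ae_map (hF.measurable p U t).aemeasurable this

theorem lintegral_pow (hF : IsRayleighFading h data P) (p : ι) (U : Plane) (t : ℕ) (n : ℕ) :
    ∫⁻ ω, ENNReal.ofReal (h p U t ω) ^ n ∂P = n.factorial := by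
  rw [← lintegral_pow_expMeasure]
  exact (hF.law p U t).lintegral_comp (f := fun s => ENNReal.ofReal s ^ n) (by fun_prop)

theorem lintegral_mul_of_ne (hF : IsRayleighFading h data P) {p q : ι} {U V : Plane} {s t : ℕ}
    (hne : (p, U, s) ≠ (q, V, t)) :
    ∫⁻ ω, ENNReal.ofReal (h p U s ω) * ENNReal.ofReal (h q V t ω) ∂P = 1 := by
  have mp := hF.measurable p U s
  have mq := hF.measurable q V t
  have h1 := lintegral_mul_eq_lintegral_mul_lintegral_of_indepFun (μ := P)
    (f := fun ω => ENNReal.ofReal (h p U s ω)) (g := fun ω => ENNReal.ofReal (h q V t ω))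
    (by fun_prop) (by fun_prop)
    ((hF.iIndep.indepFun hne).comp ENNReal.measurable_ofReal ENNReal.measurable_ofReal)
  simp only [Pi.mul_apply] at h1
  rw [h1]
  simpa using congrArg₂ (· * ·) (hF.lintegral_pow p U s 1) (hF.lintegral_pow q V t 1)

theorem lintegral_mul_data (hF : IsRayleighFading h data P) {p q : ι} {U V : Plane} {s t : ℕ}
    (hd : Measurable data) {w : β → ℝ≥0∞} (hw : Measurable w) :
    ∫⁻ ω, ENNReal.ofReal (h p U s ω) * ENNReal.ofReal (h q V t ω) * w (data ω) ∂P =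
      (∫⁻ ω, ENNReal.ofReal (h p U s ω) * ENNReal.ofReal (h q V t ω) ∂P) *
        ∫⁻ ω, w (data ω) ∂P := by
  have mp := hF.measurable p U s
  have mq := hF.measurable q V t
  exact lintegral_mul_eq_lintegral_mul_lintegral_of_indepFun (μ := P)
    (f := fun ω => ENNReal.ofReal (h p U s ω) * ENNReal.ofReal (h q V t ω))
    (g := fun ω => w (data ω)) (by fun_prop) (by fun_prop)
    (hF.indep_data.comp (φ := fun a : ι × Plane × ℕ → ℝ =>
      ENNReal.ofReal (a (p, U, s)) * ENNReal.ofReal (a (q, V, t))) (by fun_prop) hw)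

end IsRayleighFading

/-- The interference at `U` in slot `t`, as an extended nonnegative number, of the points `X p`
with weights `K p`, for the path loss `g`. -/
noncomputable def extendedInterference {Ω ι : Type*} (g : Plane → ℝ≥0∞) (K : ι → Ω → ℝ≥0∞) (X : ι → Ω → Plane)
    (h : ι → Plane → ℕ → Ω → ℝ) (U : Plane) (t : ℕ) (ω : Ω) : ℝ≥0∞ :=
  ∑' p, ENNReal.ofReal (h p U t ω) * (K p ω * g (X p ω - U))

section ExtendedInterference

variable {Ω ι : Type*} [MeasurableSpace Ω] [Countable ι] {P : Measure Ω}
  {K : ι → Ω → ℝ≥0∞} {X : ι → Ω → Plane} {h : ι → Plane → ℕ → Ω → ℝ}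
  {lam B : ℝ≥0∞} {Q : (Plane × Plane → ℝ≥0∞) → ℝ≥0∞} {g : Plane → ℝ≥0∞}

namespace HasPairMoments

theorem measurable_extendedInterference (hm : HasPairMoments K X P lam Q B)
    (hF : IsRayleighFading h (fun ω p => (K p ω, X p ω)) P) (hg : Measurable g) (U : Plane)
    (t : ℕ) : Measurable (extendedInterference g K X h U t) := by
  refine Measurable.tsum fun p => ?_
  have := hF.measurable p U t
  have := hm.measurable_weight p
  have := hm.measurable_point p
  fun_prop

theorem lintegral_extendedInterference (hm : HasPairMoments K X P lam Q B)
    (hF : IsRayleighFading h (fun ω p => (K p ω, X p ω)) P) (hg : Measurable g) (U : Plane)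
    (t : ℕ) : ∫⁻ ω, extendedInterference g K X h U t ω ∂P = lam * ∫⁻ x, g x := by
  have mh := hF.measurable
  have mK := hm.measurable_weight
  have mX := hm.measurable_point
  unfold extendedInterference
  rw [lintegral_tsum fun p => by fun_prop, ← lintegral_sub_right_eq_self g U,
    ← hm.first (fun x => g (x - U)) (by fun_prop)]
  refine tsum_congr fun p => ?_
  have h1 := lintegral_mul_eq_lintegral_mul_lintegral_of_indepFun (μ := P)
    (f := fun ω => ENNReal.ofReal (h p U t ω))
    (g := fun ω => K p ω * g (X p ω - U)) (by fun_prop) (by fun_prop)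
    (hF.indep_data.comp (φ := fun a : ι × Plane × ℕ → ℝ => ENNReal.ofReal (a (p, U, t)))
      (ψ := fun z : ι → ℝ≥0∞ × Plane => (z p).1 * g ((z p).2 - U)) (by fun_prop) (by fun_prop))
  simp only [Pi.mul_apply] at h1
  rw [h1]
  have := hF.lintegral_pow p U t 1
  simp only [pow_one] at this
  rw [this]
  simp

/-- Tonelli needs no convergence in extended nonnegative numbers; independence then separates the
fading from the geometry term by term. -/
theorem lintegral_extendedInterference_mul_eq_tsum
    (hm : HasPairMoments K X P lam Q B)
    (hF : IsRayleighFading h (fun ω p => (K p ω, X p ω)) P) (hg : Measurable g) (U V : Plane)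
    (s t : ℕ) :
    ∫⁻ ω, extendedInterference g K X h U s ω * extendedInterference g K X h V t ω ∂P =
      ∑' p, ∑' q, (∫⁻ ω, ENNReal.ofReal (h p U s ω) * ENNReal.ofReal (h q V t ω) ∂P) *
        ∫⁻ ω, K p ω * K q ω * (g (X p ω - U) * g (X q ω - V)) ∂P := by
  have mh := hF.measurable
  have mK := hm.measurable_weight
  have mX := hm.measurable_point
  unfold extendedInterference
  simp_rw [← ENNReal.tsum_mul_right, ← ENNReal.tsum_mul_left]
  rw [lintegral_tsum fun p => by fun_prop]
  refine tsum_congr fun p => ?_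
  rw [lintegral_tsum fun q => by fun_prop]
  refine tsum_congr fun q => ?_
  rw [← hF.lintegral_mul_data (p := p) (q := q) (U := U) (V := V) (s := s) (t := t)
    (w := fun z : ι → ℝ≥0∞ × Plane =>
      (z p).1 * (z q).1 * (g ((z p).2 - U) * g ((z q).2 - V))) (by fun_prop) (by fun_prop)]
  exact lintegral_congr fun ω => by ring

omit [Countable ι] in
theorem tsum_tsum_lintegral_mul (hm : HasPairMoments K X P lam Q B) (hg : Measurable g)
    (U V : Plane) :
    ∑' p, ∑' q, ∫⁻ ω, K p ω * K q ω * (g (X p ω - U) * g (X q ω - V)) ∂P =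
      (lam * ∫⁻ x, g x) ^ 2 + Q (fun z => g (z.1 - U) * g (z.2 - V)) +
        lam * ∫⁻ x, g x * g (x + (V - U)) := by
  rw [hm.second (fun z => g (z.1 - U) * g (z.2 - V)) (by fun_prop)]
  congr 2
  · rw [mul_pow, sq (∫⁻ x, g x)]
    congr 1
    rw [lintegral_lintegral_mul (f := fun x => g (x - U)) (g := fun y => g (y - V))
      (by fun_prop) (by fun_prop), lintegral_sub_right_eq_self g U,
      lintegral_sub_right_eq_self g V]
  · rw [← lintegral_sub_right_eq_self (fun x => g x * g (x + (V - U))) V]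
    refine lintegral_congr fun x => ?_
    rw [mul_comm, sub_add_sub_cancel]

/-- Since location or slot differ, the two gains are independent even for the same interferer, so
every fading factor is 1. -/
theorem lintegral_extendedInterference_mul (hm : HasPairMoments K X P lam Q B)
    (hF : IsRayleighFading h (fun ω p => (K p ω, X p ω)) P) (hg : Measurable g) {U V : Plane}
    {s t : ℕ} (hne : (U, s) ≠ (V, t)) :
    ∫⁻ ω, extendedInterference g K X h U s ω * extendedInterference g K X h V t ω ∂P =
      (lam * ∫⁻ x, g x) ^ 2 + Q (fun z => g (z.1 - U) * g (z.2 - V)) +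
        lam * ∫⁻ x, g x * g (x + (V - U)) := by
  rw [hm.lintegral_extendedInterference_mul_eq_tsum hF hg, ← hm.tsum_tsum_lintegral_mul hg]
  refine tsum_congr fun p => tsum_congr fun q => ?_
  rw [hF.lintegral_mul_of_ne fun h => hne (Prod.mk.inj h).2, one_mul]

/-- Now an interferer paired with itself has fading factor E[h²] = 2, so the diagonal is counted
once more than in `tsum_tsum_lintegral_mul`. -/
theorem lintegral_extendedInterference_sq (hm : HasPairMoments K X P lam Q B)
    (hF : IsRayleighFading h (fun ω p => (K p ω, X p ω)) P) (hg : Measurable g) (U : Plane)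
    (t : ℕ) :
    ∫⁻ ω, extendedInterference g K X h U t ω * extendedInterference g K X h U t ω ∂P =
      (lam * ∫⁻ x, g x) ^ 2 + Q (fun z => g (z.1 - U) * g (z.2 - U)) +
        2 * lam * ∫⁻ x, g x ^ 2 := by
  classical
  have hd : ∑' p, ∫⁻ ω, K p ω * K p ω * (g (X p ω - U) * g (X p ω - U)) ∂P =
      lam * ∫⁻ x, g x ^ 2 := by
    rw [← lintegral_sub_right_eq_self _ U, ← hm.first _ (by fun_prop)]
    simp_rw [hm.weight_mul_self, sq]
  have h2 := hm.tsum_tsum_lintegral_mul hg U U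
  simp only [sub_self, add_zero, ← sq] at h2
  rw [hm.lintegral_extendedInterference_mul_eq_tsum hF hg, two_mul, add_mul, ← add_assoc, ← h2, ← hd,
    ← ENNReal.tsum_add]
  refine tsum_congr fun p => ?_
  rw [← tsum_ite_eq p fun q => ∫⁻ ω, K q ω * K q ω * (g (X q ω - U) * g (X q ω - U)) ∂P,
    ← ENNReal.tsum_add]
  refine tsum_congr fun q => ?_
  by_cases hq : q = p
  · subst hq
    have := hF.lintegral_pow q U t 2
    simp only [sq] at this
    rw [this, if_pos rfl, ← two_mul]
    simp
  · rw [hF.lintegral_mul_of_ne fun h => hq (Prod.mk.inj h).1.symm, one_mul, if_neg hq, add_zero]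

end HasPairMoments

end ExtendedInterference

/-! ### From extended to real-valued moments -/

theorem lintegral_pathLoss {α ε : ℝ} (hα : 2 < α) (hε : 0 < ε) :
    ∫⁻ x, ENNReal.ofReal (pathLoss α ε x) = ENNReal.ofReal (∫ x, pathLoss α ε x) :=
  (ofReal_integral_eq_lintegral_ofReal (integrable_pathLoss hα hε)
    (.of_forall fun x => (pathLoss_pos hε x).le)).symm

theorem lintegral_pathLoss_mul {α ε : ℝ} (hα : 2 < α) (hε : 0 < ε) (V : Plane) :
    ∫⁻ x, ENNReal.ofReal (pathLoss α ε x) * ENNReal.ofReal (pathLoss α ε (x + V)) =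
      ENNReal.ofReal (∫ x, pathLoss α ε x * pathLoss α ε (x + V)) := by
  rw [ofReal_integral_eq_lintegral_ofReal (integrable_pathLoss_mul hα hε V)
    (.of_forall fun x => (mul_pos (pathLoss_pos hε x) (pathLoss_pos hε _)).le)]
  exact lintegral_congr fun x => (ENNReal.ofReal_mul (pathLoss_pos hε x).le).symm

theorem lintegral_pathLoss_sq {α ε : ℝ} (hα : 2 < α) (hε : 0 < ε) :
    ∫⁻ x, ENNReal.ofReal (pathLoss α ε x) ^ 2 = ENNReal.ofReal (∫ x, pathLoss α ε x ^ 2) := by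
  simpa [sq] using lintegral_pathLoss_mul hα hε 0

/-- The excess of the second moment of the interference over that for a Poisson process. -/
noncomputable def clusterCovariance (Q : (Plane × Plane → ℝ≥0∞) → ℝ≥0∞) (α : ℝ) (U V : Plane) (ε : ℝ) : ℝ :=
  (Q fun z => ENNReal.ofReal (pathLoss α ε (z.1 - U)) *
    ENNReal.ofReal (pathLoss α ε (z.2 - V))).toReal

section Interference

variable {Ω ι : Type*} [MeasurableSpace Ω] [Countable ι] {P : Measure Ω}
  {K : ι → Ω → ℝ≥0∞} {X : ι → Ω → Plane} {h : ι → Plane → ℕ → Ω → ℝ}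
  {position : ι → Ω → Option Plane}
  {lam B : ℝ≥0∞} {Q : (Plane × Plane → ℝ≥0∞) → ℝ≥0∞} {α ε : ℝ}

namespace HasPairMoments

omit [Countable ι] in
theorem excess_le (hm : HasPairMoments K X P lam Q B) (hα : 2 < α) (hε : 0 < ε) (U V : Plane) :
    Q (fun z => ENNReal.ofReal (pathLoss α ε (z.1 - U)) *
      ENNReal.ofReal (pathLoss α ε (z.2 - V))) ≤
      B * ENNReal.ofReal ((∫ x, pathLoss α ε x) ^ 2) := by
  refine (hm.bound _ (by fun_prop)).trans_eq ?_
  congr 1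
  rw [lintegral_lintegral_mul (f := fun x => ENNReal.ofReal (pathLoss α ε (x - U)))
      (g := fun y => ENNReal.ofReal (pathLoss α ε (y - V))) (by fun_prop) (by fun_prop),
    lintegral_sub_right_eq_self (fun x => ENNReal.ofReal (pathLoss α ε x)) U,
    lintegral_sub_right_eq_self (fun x => ENNReal.ofReal (pathLoss α ε x)) V,
    lintegral_pathLoss hα hε, sq, ENNReal.ofReal_mul (integral_pathLoss_pos hα hε).le]

omit [Countable ι] in
theorem abs_clusterCovariance_le (hm : HasPairMoments K X P lam Q B) (hB : B ≠ ∞) (hα : 2 < α)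
    (hε : 0 < ε) (U V : Plane) :
    |clusterCovariance Q α U V ε| ≤ B.toReal * (∫ x, pathLoss α ε x) ^ 2 := by
  rw [clusterCovariance, abs_of_nonneg ENNReal.toReal_nonneg]
  refine (ENNReal.toReal_mono (by finiteness) (hm.excess_le hα hε U V)).trans_eq ?_
  rw [ENNReal.toReal_mul, ENNReal.toReal_ofReal (by positivity)]

theorem _root_.ae_interferenceTerm (hF : IsRayleighFading h (fun ω p => (K p ω, X p ω)) P) (hε : 0 < ε)
    (hpos : ∀ p ω (φ : Plane → ℝ), (position p ω).elim 0 φ = (K p ω).toReal * φ (X p ω))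
    (U : Plane) (t : ℕ) : ∀ᵐ ω ∂P, ∀ p, interferenceTerm α ε position h U t ω p =
      (ENNReal.ofReal (h p U t ω) *
        (K p ω * ENNReal.ofReal (pathLoss α ε (X p ω - U)))).toReal := by
  rw [ae_all_iff]
  intro p
  filter_upwards [hF.ae_nonneg p U t] with ω hω
  rw [interferenceTerm, hpos, ENNReal.toReal_mul, ENNReal.toReal_mul, ENNReal.toReal_ofReal hω,
    ENNReal.toReal_ofReal (pathLoss_pos hε _).le]
  ring

/-- The extended interference has finite mean, hence is almost surely finite, and a finite sum of
extended nonnegative terms may be taken in the reals. -/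
theorem ae_summable_and_interference_eq (hm : HasPairMoments K X P lam Q B) (hlam : lam ≠ ∞)
    (hF : IsRayleighFading h (fun ω p => (K p ω, X p ω)) P) (hα : 2 < α) (hε : 0 < ε)
    (hpos : ∀ p ω (φ : Plane → ℝ), (position p ω).elim 0 φ = (K p ω).toReal * φ (X p ω))
    (U : Plane) (t : ℕ) : ∀ᵐ ω ∂P, Summable (interferenceTerm α ε position h U t ω) ∧
      interference α ε position h U t ω = (extendedInterference
        (fun x => ENNReal.ofReal (pathLoss α ε x)) K X h U t ω).toReal := by
  have hlt := ae_lt_top (hm.measurable_extendedInterference hF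
    (g := fun x => ENNReal.ofReal (pathLoss α ε x)) (by fun_prop) U t) (by
      rw [hm.lintegral_extendedInterference hF (by fun_prop), lintegral_pathLoss hα hε]
      finiteness)
  filter_upwards [hlt, ae_interferenceTerm (α := α) hF hε hpos U t] with ω h1 h2
  have h3 : interferenceTerm α ε position h U t ω = fun p => _ := funext h2
  rw [interference, h3]
  refine ⟨ENNReal.summable_toReal h1.ne, ?_⟩
  rw [extendedInterference, ENNReal.tsum_toReal_eq (ENNReal.ne_top_of_tsum_ne_top h1.ne)]

theorem integral_interference (hm : HasPairMoments K X P lam Q B) (hlam : lam ≠ ∞)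
    (hF : IsRayleighFading h (fun ω p => (K p ω, X p ω)) P) (hα : 2 < α) (hε : 0 < ε)
    (hpos : ∀ p ω (φ : Plane → ℝ), (position p ω).elim 0 φ = (K p ω).toReal * φ (X p ω))
    (U : Plane) (t : ℕ) :
    ∫ ω, interference α ε position h U t ω ∂P = lam.toReal * ∫ x, pathLoss α ε x := by
  have hmJ := hm.measurable_extendedInterference hF
    (g := fun x => ENNReal.ofReal (pathLoss α ε x)) (by fun_prop) U t
  have hJ := hm.lintegral_extendedInterference hF
    (g := fun x => ENNReal.ofReal (pathLoss α ε x)) (by fun_prop) U t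
  rw [lintegral_pathLoss hα hε] at hJ
  rw [integral_congr_ae ((hm.ae_summable_and_interference_eq hlam hF hα hε hpos U t).mono
    fun ω hω => hω.2), integral_toReal hmJ.aemeasurable (ae_lt_top hmJ (by rw [hJ]; finiteness)),
    hJ, ENNReal.toReal_mul, ENNReal.toReal_ofReal (integral_pathLoss_pos hα hε).le]

omit [Countable ι] in
theorem toReal_second_moment (hm : HasPairMoments K X P lam Q B) (hlam : lam ≠ ∞) (hB : B ≠ ∞)
    (hα : 2 < α) (hε : 0 < ε) (U V : Plane) {c : ℝ≥0∞} (hc : c ≠ ∞) {r : ℝ} (hr : 0 ≤ r)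
    {J : ℝ≥0∞} (hJ : J = (lam * ENNReal.ofReal (∫ x, pathLoss α ε x)) ^ 2 +
      Q (fun z => ENNReal.ofReal (pathLoss α ε (z.1 - U)) *
        ENNReal.ofReal (pathLoss α ε (z.2 - V))) + c * ENNReal.ofReal r) :
    J ≠ ∞ ∧ J.toReal = (lam.toReal * ∫ x, pathLoss α ε x) ^ 2 + clusterCovariance Q α U V ε +
      c.toReal * r := by
  have hQ := ne_top_of_le_ne_top (by finiteness) (hm.excess_le hα hε U V)
  subst hJ
  refine ⟨by finiteness, ?_⟩
  rw [ENNReal.toReal_add (by finiteness) (by finiteness), ENNReal.toReal_add (by finiteness) hQ,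
    ENNReal.toReal_pow, ENNReal.toReal_mul, ENNReal.toReal_mul, ENNReal.toReal_ofReal hr,
    ENNReal.toReal_ofReal (integral_pathLoss_pos hα hε).le, clusterCovariance]

theorem integral_interference_mul_eq_toReal (hm : HasPairMoments K X P lam Q B) (hlam : lam ≠ ∞)
    (hF : IsRayleighFading h (fun ω p => (K p ω, X p ω)) P) (hα : 2 < α) (hε : 0 < ε)
    (hpos : ∀ p ω (φ : Plane → ℝ), (position p ω).elim 0 φ = (K p ω).toReal * φ (X p ω))
    (U V : Plane) (s t : ℕ)
    (hfin : ∫⁻ ω, extendedInterference (fun x => ENNReal.ofReal (pathLoss α ε x)) K X h U s ω *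
      extendedInterference (fun x => ENNReal.ofReal (pathLoss α ε x)) K X h V t ω ∂P ≠ ∞) :
    Integrable (fun ω => interference α ε position h U s ω * interference α ε position h V t ω) P ∧
    ∫ ω, interference α ε position h U s ω * interference α ε position h V t ω ∂P =
      (∫⁻ ω, extendedInterference (fun x => ENNReal.ofReal (pathLoss α ε x)) K X h U s ω *
      extendedInterference (fun x => ENNReal.ofReal (pathLoss α ε x)) K X h V t ω ∂P).toReal := by
  have hJ (U t) := hm.measurable_extendedInterference hF
    (g := fun x => ENNReal.ofReal (pathLoss α ε x)) (by fun_prop) U t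
  have h1 := hJ U s
  have h2 := hJ V t
  have he : (fun ω => interference α ε position h U s ω * interference α ε position h V t ω) =ᵐ[P]
      fun ω => (extendedInterference (fun x => ENNReal.ofReal (pathLoss α ε x)) K X h U s ω *
        extendedInterference (fun x => ENNReal.ofReal (pathLoss α ε x)) K X h V t ω).toReal := by
    filter_upwards [hm.ae_summable_and_interference_eq hlam hF hα hε hpos U s,
      hm.ae_summable_and_interference_eq hlam hF hα hε hpos V t] with ω h1 h2
    rw [h1.2, h2.2, ENNReal.toReal_mul]
  refine ⟨(integrable_toReal_of_lintegral_ne_top (by fun_prop) hfin).congr he.symm, ?_⟩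
  rw [integral_congr_ae he, integral_toReal (by fun_prop) (ae_lt_top (by fun_prop) hfin)]

theorem integral_interference_mul (hm : HasPairMoments K X P lam Q B) (hlam : lam ≠ ∞)
    (hB : B ≠ ∞) (hF : IsRayleighFading h (fun ω p => (K p ω, X p ω)) P) (hα : 2 < α) (hε : 0 < ε)
    (hpos : ∀ p ω (φ : Plane → ℝ), (position p ω).elim 0 φ = (K p ω).toReal * φ (X p ω))
    {U V : Plane} {s t : ℕ} (hne : (U, s) ≠ (V, t)) :
    ∫ ω, interference α ε position h U s ω * interference α ε position h V t ω ∂P =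
      (lam.toReal * ∫ x, pathLoss α ε x) ^ 2 + clusterCovariance Q α U V ε +
        lam.toReal * ∫ x, pathLoss α ε x * pathLoss α ε (x + (V - U)) := by
  have hJ := hm.lintegral_extendedInterference_mul hF
    (g := fun x => ENNReal.ofReal (pathLoss α ε x)) (by fun_prop) hne
  rw [lintegral_pathLoss hα hε, lintegral_pathLoss_mul hα hε] at hJ
  have h2 := hm.toReal_second_moment hlam hB hα hε U V hlam
    (integral_nonneg fun x => (mul_pos (pathLoss_pos hε _) (pathLoss_pos hε _)).le) hJ
  rw [(hm.integral_interference_mul_eq_toReal hlam hF hα hε hpos U V s t h2.1).2, h2.2]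

theorem memLp_interference_and_variance [IsProbabilityMeasure P]
    (hm : HasPairMoments K X P lam Q B) (hlam : lam ≠ ∞)
    (hB : B ≠ ∞) (hF : IsRayleighFading h (fun ω p => (K p ω, X p ω)) P) (hα : 2 < α) (hε : 0 < ε)
    (hpos : ∀ p ω (φ : Plane → ℝ), (position p ω).elim 0 φ = (K p ω).toReal * φ (X p ω))
    (U : Plane) (t : ℕ) : MemLp (interference α ε position h U t) 2 P ∧
      variance (interference α ε position h U t) P =
        2 * lam.toReal * (∫ x, pathLoss α ε x ^ 2) + clusterCovariance Q α U U ε := by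
  have hJ := hm.lintegral_extendedInterference_sq hF
    (g := fun x => ENNReal.ofReal (pathLoss α ε x)) (by fun_prop) U t
  rw [lintegral_pathLoss hα hε, lintegral_pathLoss_sq hα hε] at hJ
  have h2 := hm.toReal_second_moment hlam hB hα hε U U (by finiteness)
    (integral_pathLoss_sq_pos hα hε).le hJ
  have h3 := hm.integral_interference_mul_eq_toReal hlam hF hα hε hpos U U t t h2.1
  have hmI : AEStronglyMeasurable (interference α ε position h U t) P :=
    (hm.measurable_extendedInterference hF (g := fun x => ENNReal.ofReal (pathLoss α ε x))
      (by fun_prop) U t).ennreal_toReal.aestronglyMeasurable.congr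
      ((hm.ae_summable_and_interference_eq hlam hF hα hε hpos U t).mono fun ω hω => hω.2.symm)
  have hL : MemLp (interference α ε position h U t) 2 P := by
    rw [memLp_two_iff_integrable_sq hmI]
    simpa only [sq] using h3.1
  refine ⟨hL, ?_⟩
  rw [variance_eq_sub hL, hm.integral_interference hlam hF hα hε hpos]
  simp only [Pi.pow_apply, sq (interference _ _ _ _ _ _ _)]
  rw [h3.2, h2.2, ENNReal.toReal_mul]
  simp
  ring

theorem interferenceRegular [IsProbabilityMeasure P] (hm : HasPairMoments K X P lam Q B) (hlam : lam ≠ ∞) (hlam₀ : lam ≠ 0)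
    (hB : B ≠ ∞) (hF : IsRayleighFading h (fun ω p => (K p ω, X p ω)) P) (hα : 2 < α) (hε : 0 < ε)
    (hpos : ∀ p ω (φ : Plane → ℝ), (position p ω).elim 0 φ = (K p ω).toReal * φ (X p ω))
    (U : Plane) (t : ℕ) : InterferenceRegular P α ε position h U t := by
  have h1 := hm.memLp_interference_and_variance hlam hB hF hα hε hpos U t
  refine ⟨(hm.ae_summable_and_interference_eq hlam hF hα hε hpos U t).mono fun ω hω => hω.1,
    h1.1, ?_⟩
  rw [h1.2]
  have := ENNReal.toReal_pos hlam₀ hlam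
  have := integral_pathLoss_sq_pos hα hε
  have : 0 ≤ clusterCovariance Q α U U ε := ENNReal.toReal_nonneg
  positivity

/-- The interference correlation coefficient exists for points with pair moments, and coincides
with the limit of the correlation ratio. -/
theorem exists_isInterferenceCorrelation [IsProbabilityMeasure P] (hm : HasPairMoments K X P lam Q B) (hlam : lam ≠ ∞)
    (hlam₀ : lam ≠ 0) (hB : B ≠ ∞) (hF : IsRayleighFading h (fun ω p => (K p ω, X p ω)) P)
    (hα : 2 < α)
    (hpos : ∀ p ω (φ : Plane → ℝ), (position p ω).elim 0 φ = (K p ω).toReal * φ (X p ω))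
    {U₁ U₂ : Plane} {t₁ t₂ : ℕ} (hne : (U₁, t₁) ≠ (U₂, t₂)) {c R : ℝ} (hR : 0 < R) :
    ∃ ζ : ℝ, IsInterferenceCorrelation P α position h U₁ U₂ t₁ t₂ ζ ∧
      Tendsto (fun ε : ℝ => correlationRatio α ε c R U₁ U₂) (𝓝[>] 0) (𝓝 ζ) := by
  classical
  -- The common limit: at one location only the gains differ, and E[h]²/E[h²] = 1/2 survives; at
  -- distinct locations nothing does.
  refine ⟨if U₂ - U₁ = 0 then 1 / 2 else 0, ⟨fun ε hε =>
    ⟨hm.interferenceRegular hlam hlam₀ hB hF hα hε hpos U₁ t₁,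
      hm.interferenceRegular hlam hlam₀ hB hF hα hε hpos U₂ t₂⟩, ?_⟩, ?_⟩
  · refine (tendsto_covariance_div_sqrt_variance hα (U₂ - U₁) (ENNReal.toReal_pos hlam₀ hlam)
      (fun ε hε => hm.abs_clusterCovariance_le hB hα hε U₁ U₂)
      (fun ε hε => hm.abs_clusterCovariance_le hB hα hε U₁ U₁)
      (fun ε hε => hm.abs_clusterCovariance_le hB hα hε U₂ U₂)).congr' ?_
    filter_upwards [self_mem_nhdsWithin] with ε hε
    rw [correlation, (hm.memLp_interference_and_variance hlam hB hF hα hε hpos U₁ t₁).2,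
      (hm.memLp_interference_and_variance hlam hB hF hα hε hpos U₂ t₂).2,
      hm.integral_interference hlam hF hα hε hpos, hm.integral_interference hlam hF hα hε hpos,
      hm.integral_interference_mul hlam hB hF hα hε hpos hne]
    congr 1
    ring
  · refine (tendsto_covariance_div_variance hα (U₂ - U₁)
      (fun ε hε => abs_clusterTerm_le hα hε (c := c) hR)).congr fun ε => ?_
    have h1 := integral_pow_expMeasure 1
    have h2 := integral_pow_expMeasure 2
    simp only [pow_one] at h1
    rw [correlationRatio, h1, h2]
    congr 2
    · refine integral_congr_ae (.of_forall fun x => ?_)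
      simp only
      congr 2
      abel
    · simp

end HasPairMoments

end Interference

/-! ### The Matérn and the second-order cluster process -/

theorem isotropicLaw_le {f : ℝ → ℝ} {b : ℝ} (hf : ∀ r, f r ≤ b) :
    isotropicLaw f ≤ ENNReal.ofReal b • volume := by
  rw [isotropicLaw, ← withDensity_const]
  exact withDensity_mono (.of_forall fun x => ENNReal.ofReal_le_ofReal (hf _))

theorem uniformDensity_le (R r : ℝ) : uniformDensity R r ≤ 1 / (Real.pi * R ^ 2) := by
  unfold uniformDensity
  split_ifs
  · exact le_rfl
  · positivity

/-- The numerator lies in [0, 1]. The absolute value makes the sign of the normalising constant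
irrelevant. -/
theorem reverseGaussianDensity_le (R σ r : ℝ) : reverseGaussianDensity R σ r ≤
    |1 / (Real.pi * R ^ 2 + 2 * Real.pi * σ ^ 2 * (Real.exp (-R ^ 2 / (2 * σ ^ 2)) - 1))| := by
  unfold reverseGaussianDensity
  split_ifs
  · have h1 : Real.exp (-r ^ 2 / (2 * σ ^ 2)) ≤ 1 := by
      rw [Real.exp_le_one_iff, neg_div]
      have : 0 ≤ r ^ 2 / (2 * σ ^ 2) := by positivity
      linarith
    refine (le_abs_self _).trans ?_
    rw [abs_div, abs_div, abs_one, abs_of_nonneg (sub_nonneg.2 h1)]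
    gcongr
    linarith [Real.exp_pos (-r ^ 2 / (2 * σ ^ 2))]
  · positivity

instance sigmaFinite_ofReal_smul_volume (lam : ℝ) :
    SigmaFinite (ENNReal.ofReal lam • (volume : Measure Plane)) :=
  inferInstanceAs (SigmaFinite (lam.toNNReal • (volume : Measure Plane)))

section Processes

variable {Ω : Type*} [MeasurableSpace Ω] {P : Measure Ω}

namespace MaternClusterProcess

variable {lam c R : ℝ} (Φ : MaternClusterProcess P lam c R)

theorem exists_hasPairMoments [IsProbabilityMeasure P] : ∃ Q, HasPairMoments
    (fun (p : ℕ × ℕ) ω => 1 * if p.2 < Φ.number p.1 ω then 1 else 0)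
    (fun p ω => Φ.parent p.1 ω + Φ.offset p.1 p.2 ω) P (c.toNNReal * ENNReal.ofReal lam) Q
    (c.toNNReal ^ 2 * (0 + ENNReal.ofReal lam * ENNReal.ofReal (1 / (Real.pi * R ^ 2)))) :=
  Φ.poisson_parent.hasPairMoments.cluster (isotropicLaw_le (uniformDensity_le R))
    Φ.measurable_number Φ.measurable_offset Φ.law_number Φ.law_offset Φ.iIndep_number
    Φ.iIndep_offset
    (Φ.indep_parent.comp (φ := fun a : ℕ → Plane => fun i => ((1 : ℝ≥0∞), a i)) (by fun_prop)
      measurable_id)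
    Φ.indep_number_offset

theorem isRayleighFading_points {h : ℕ × ℕ → Plane → ℕ → Ω → ℝ}
    (hF : IsRayleighFading h Φ.data P) : IsRayleighFading h (fun ω (p : ℕ × ℕ) =>
      ((1 * if p.2 < Φ.number p.1 ω then 1 else 0 : ℝ≥0∞),
        Φ.parent p.1 ω + Φ.offset p.1 p.2 ω)) P := by
  refine hF.comp (f := fun z (p : ℕ × ℕ) =>
    ((1 * if p.2 < z.2.1 p.1 then 1 else 0 : ℝ≥0∞), z.1 p.1 + z.2.2 p.1 p.2)) ?_
  refine measurable_pi_lambda _ fun p => Measurable.prodMk ?_ (by fun_prop)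
  exact (Measurable.of_discrete (f := fun n : ℕ => (1 * if p.2 < n then 1 else 0 : ℝ≥0∞))).comp
    (by fun_prop)

theorem position_elim (p : ℕ × ℕ) (ω : Ω) (φ : Plane → ℝ) : (Φ.position p ω).elim 0 φ =
    (1 * if p.2 < Φ.number p.1 ω then 1 else 0 : ℝ≥0∞).toReal *
      φ (Φ.parent p.1 ω + Φ.offset p.1 p.2 ω) := by
  unfold position
  split_ifs <;> simp

end MaternClusterProcess

namespace SecondOrderClusterProcess

variable {lam c' R' σ c R : ℝ} (Φ : SecondOrderClusterProcess P lam c' R' σ c R)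

/-- The weights that tell which of the labels of a second-order cluster process are in use. -/
noncomputable def weight (p : ℕ × ℕ × ℕ) (ω : Ω) : ℝ≥0∞ :=
  (1 * if p.2.1 < Φ.number₁ p.1 ω then 1 else 0) * if p.2.2 < Φ.number₂ p.1 p.2.1 ω then 1 else 0

theorem exists_hasPairMoments [IsProbabilityMeasure P] : ∃ Q, HasPairMoments Φ.weight
    (fun p ω => Φ.parent p.1 ω + Φ.offset₁ p.1 p.2.1 ω + Φ.offset₂ p.1 p.2.1 p.2.2 ω) P
    (c.toNNReal * (c'.toNNReal * ENNReal.ofReal lam)) Q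
    (c.toNNReal ^ 2 * (c'.toNNReal ^ 2 * (0 + ENNReal.ofReal lam * ENNReal.ofReal
      |1 / (Real.pi * R' ^ 2 + 2 * Real.pi * σ ^ 2 * (Real.exp (-R' ^ 2 / (2 * σ ^ 2)) - 1))|) +
      c'.toNNReal * ENNReal.ofReal lam * ENNReal.ofReal (1 / (Real.pi * R ^ 2)))) := by
  have mn₁ := Φ.measurable_number₁
  have mo₁ := Φ.measurable_offset₁
  have mn₂ := Φ.measurable_number₂
  have mo₂ := Φ.measurable_offset₂
  have mp := Φ.poisson_parent.measurable
  obtain ⟨Q₁, h₁⟩ := Φ.poisson_parent.hasPairMoments.cluster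
    (isotropicLaw_le (reverseGaussianDensity_le R' σ))
    Φ.measurable_number₁ Φ.measurable_offset₁ Φ.law_number₁ Φ.law_offset₁ Φ.iIndep_number₁
    Φ.iIndep_offset₁
    (Φ.indep_parent.comp (φ := fun a : ℕ → Plane => fun i => ((1 : ℝ≥0∞), a i))
      (ψ := fun z : (ℕ → ℕ) × (ℕ → ℕ → Plane) × (ℕ → ℕ → ℕ) × (ℕ → ℕ → ℕ → Plane) =>
        (z.1, z.2.1)) (by fun_prop) (by fun_prop))
    (Φ.indep_number₁.comp measurable_id measurable_fst)
  -- The nested independence hypotheses are regrouped: everything that builds the first-order points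
  -- is independent of the second-order sizes and displacements.
  have hi₁ := IndepFun.prodMk_left (by fun_prop) (by fun_prop) (by fun_prop) Φ.indep_number₁
    Φ.indep_offset₁
  have hi₂ := IndepFun.prodMk_left (by fun_prop) (by fun_prop) (by fun_prop)
    (Φ.indep_parent.comp measurable_id
      (ψ := fun z : (ℕ → ℕ) × (ℕ → ℕ → Plane) × (ℕ → ℕ → ℕ) × (ℕ → ℕ → ℕ → Plane) =>
        ((z.1, z.2.1), z.2.2)) (by fun_prop)) hi₁
  -- The first-order points, no longer Poisson but with pair moments, serve as parents of a second
  -- clustering.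
  obtain ⟨Q₂, h₂⟩ := h₁.cluster (n := fun p : ℕ × ℕ => Φ.number₂ p.1 p.2)
    (o := fun p : ℕ × ℕ => Φ.offset₂ p.1 p.2)
    (isotropicLaw_le (uniformDensity_le R))
    (fun p => Φ.measurable_number₂ p.1 p.2) (fun p => Φ.measurable_offset₂ p.1 p.2)
    (fun p => Φ.law_number₂ p.1 p.2) (fun p => Φ.law_offset₂ p.1 p.2) Φ.iIndep_number₂
    (Φ.iIndep_offset₂.precomp (g := Equiv.prodAssoc ℕ ℕ ℕ) (Equiv.injective _))
    (hi₂.comp (φ := fun (z : (ℕ → Plane) × (ℕ → ℕ) × (ℕ → ℕ → Plane)) (p : ℕ × ℕ) =>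
        ((1 * if p.2 < z.2.1 p.1 then 1 else 0 : ℝ≥0∞), z.1 p.1 + z.2.2 p.1 p.2))
      (ψ := fun z : (ℕ → ℕ → ℕ) × (ℕ → ℕ → ℕ → Plane) =>
        ((fun p : ℕ × ℕ => z.1 p.1 p.2), fun (p : ℕ × ℕ) k => z.2 p.1 p.2 k))
      (by
        refine measurable_pi_lambda _ fun p => Measurable.prodMk ?_ (by fun_prop)
        exact (Measurable.of_discrete
          (f := fun n : ℕ => (1 * if p.2 < n then 1 else 0 : ℝ≥0∞))).comp (by fun_prop))
      (by fun_prop))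
    (Φ.indep_number₂.comp (φ := fun (z : ℕ → ℕ → ℕ) (p : ℕ × ℕ) => z p.1 p.2)
      (ψ := fun (z : ℕ → ℕ → ℕ → Plane) (p : ℕ × ℕ) k => z p.1 p.2 k) (by fun_prop) (by fun_prop))
  exact ⟨Q₂, h₂.reindex (Equiv.prodAssoc ℕ ℕ ℕ).symm⟩

theorem isRayleighFading_points {h : ℕ × ℕ × ℕ → Plane → ℕ → Ω → ℝ}
    (hF : IsRayleighFading h Φ.data P) : IsRayleighFading h (fun ω (p : ℕ × ℕ × ℕ) =>
      (Φ.weight p ω,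
        Φ.parent p.1 ω + Φ.offset₁ p.1 p.2.1 ω + Φ.offset₂ p.1 p.2.1 p.2.2 ω)) P := by
  refine hF.comp (f := fun z (p : ℕ × ℕ × ℕ) =>
    (((1 * if p.2.1 < z.2.1 p.1 then 1 else 0) * if p.2.2 < z.2.2.2.1 p.1 p.2.1 then 1 else 0 :
      ℝ≥0∞), z.1 p.1 + z.2.2.1 p.1 p.2.1 + z.2.2.2.2 p.1 p.2.1 p.2.2)) ?_
  refine measurable_pi_lambda _ fun p => Measurable.prodMk ?_ (by fun_prop)
  exact (Measurable.of_discrete (f := fun n : ℕ × ℕ => ((1 * if p.2.1 < n.1 then 1 else 0) *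
    if p.2.2 < n.2 then 1 else 0 : ℝ≥0∞))).comp
    (g := fun n : ℕ × ℕ => _) (f := fun z : (ℕ → Plane) × (ℕ → ℕ) × (ℕ → ℕ → Plane) ×
      (ℕ → ℕ → ℕ) × (ℕ → ℕ → ℕ → Plane) => (z.2.1 p.1, z.2.2.2.1 p.1 p.2.1)) (by fun_prop)

theorem position_elim (p : ℕ × ℕ × ℕ) (ω : Ω) (φ : Plane → ℝ) : (Φ.position p ω).elim 0 φ =
    (Φ.weight p ω).toReal *
      φ (Φ.parent p.1 ω + Φ.offset₁ p.1 p.2.1 ω + Φ.offset₂ p.1 p.2.1 p.2.2 ω) := by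
  unfold position weight
  by_cases h₁ : p.2.1 < Φ.number₁ p.1 ω <;> by_cases h₂ : p.2.2 < Φ.number₂ p.1 p.2.1 ω <;>
    simp [h₁, h₂]

end SecondOrderClusterProcess

end Processes

theorem theorem1 (α : ℝ) (hα : 2 < α) (U₁ U₂ : Plane) (t₁ t₂ : ℕ)
    (hne : (U₁, t₁) ≠ (U₂, t₂)) :
    -- all integrals in the closed form converge
    (∀ ε : ℝ, 0 < ε →
      Integrable (fun x : Plane => pathLoss α ε x * pathLoss α ε (x - U₁ + U₂)) ∧
      Integrable (fun x : Plane => pathLoss α ε x ^ 2) ∧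
      ∀ R : ℝ, 0 < R → Integrable
        (fun z : Plane × Plane =>
          pathLoss α ε z.1 * pathLoss α ε z.2 * diskOverlap R ‖z.1 - z.2‖)) ∧
    -- Matérn cluster process
    (∀ (lam c R : ℝ), 0 < lam → 0 < c → 0 < R →
      ∀ (Ω : Type*) [MeasurableSpace Ω] (P : Measure Ω) [IsProbabilityMeasure P]
        (Φ : MaternClusterProcess P lam c R) (h : ℕ × ℕ → Plane → ℕ → Ω → ℝ),
        IsRayleighFading h Φ.data P →
        ∃ ζ : ℝ, IsInterferenceCorrelation P α Φ.position h U₁ U₂ t₁ t₂ ζ ∧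
          Tendsto (fun ε : ℝ => correlationRatio α ε c R U₁ U₂) (𝓝[>] 0) (𝓝 ζ)) ∧
    -- second-order cluster process
    (∀ (lam c' R' σ c R : ℝ), 0 < lam → 0 < c' → 0 < R' → 0 < σ → 0 < c → 0 < R →
      ∀ (Ω : Type*) [MeasurableSpace Ω] (P : Measure Ω) [IsProbabilityMeasure P]
        (Φ : SecondOrderClusterProcess P lam c' R' σ c R)
        (h : ℕ × ℕ × ℕ → Plane → ℕ → Ω → ℝ),
        IsRayleighFading h Φ.data P →
        ∃ ζ : ℝ, IsInterferenceCorrelation P α Φ.position h U₁ U₂ t₁ t₂ ζ ∧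
          Tendsto (fun ε : ℝ => correlationRatio α ε c R U₁ U₂) (𝓝[>] 0) (𝓝 ζ)) := by
  refine ⟨fun ε hε => ⟨?_, integrable_pathLoss_sq hα hε,
    fun R hR => integrable_pathLoss_mul_diskOverlap hα hε hR⟩, ?_, ?_⟩
  · simpa only [sub_add_eq_add_sub, add_sub_assoc] using
      integrable_pathLoss_mul hα hε (U₂ - U₁)
  · intro lam c R hlam hc hR Ω _ P _ Φ h hF
    obtain ⟨Q, hm⟩ := Φ.exists_hasPairMoments
    exact hm.exists_isInterferenceCorrelation (by finiteness) (by simp [hlam, hc])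
      (by finiteness) (Φ.isRayleighFading_points hF) hα Φ.position_elim hne hR
  · intro lam c' R' σ c R hlam hc' hR' hσ hc hR Ω _ P _ Φ h hF
    obtain ⟨Q, hm⟩ := Φ.exists_hasPairMoments
    exact hm.exists_isInterferenceCorrelation (by finiteness) (by simp [hlam, hc, hc'])
      (by finiteness) (Φ.isRayleighFading_points hF) hα Φ.position_elim hne hR
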